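/- Conventions. A smooth bounded domain $\Omega\subset\mathbb{R}^n$ is a nonempty, connected, bounded open set with $C^\infty$ boundary. For $\delta>0$ let $K_\delta:=\{x\in\Omega:\operatorname{dist}(x,\partial\Omega)\ge\delta\}$. For $f\in C^1(\mathbb{R})$, a smooth stable solution of $-\Delta u=f(u)$ in $\Omega$ is a function $u\in C^\infty(\overline\Omega)$ with $-\Delta u=f(u)$ in $\Omega$ (no boundary condition is imposed) and $$\int_\Omega f'(u)\,\xi^2\,dx\le\int_\Omega|\nabla\xi|^2\,dx\qquad\text{for all }\xi\in C^1(\overline\Omega)\text{ with }\xi|_{\partial\Omega}\equiv 0.$$ **Proposition 1.2.** (i) Let $\Omega\subset\mathbb{R}^n$ be a smooth bounded domain, let $\delta>0$, and let $\alpha$ satisfy $$0\le\alpha<n-1\quad\text{and}\quad\frac{(\alpha-2)^2}{4}<\frac{(n-1-\alpha)^2}{n-1}.$$ Then there is a constant $C$, depending only on $\Omega$, $\delta$ and $\alpha$, such that for every $f\in C^1(\mathbb{R})$, every smooth stable solution $u$ of $-\Delta u=f(u)$ in $\Omega$, and every $y\in K_\delta$, $$\int_\Omega|\nabla u(x)|^2\,|x-y|^{-\alpha}\,dx\le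 C\,\|\nabla u\|^2_{L^2(\Omega\setminus K_\delta)},$$ the left-hand integral being finite. (ii) Let $\Omega=\{x\in\mathbb{R}^n:|x|<R\}$ be a ball centered at the origin, $R>0$, let $\delta>0$, and let $\alpha$ satisfy $$0\le\alpha<n-1\quad\text{and}\quad\frac{(\alpha-2)^2}{4}<n-1.$$ Then there is a constant $C$, depending only on $\Omega$, $\delta$ and $\alpha$, such that for every $f\in C^1(\mathbb{R})$ and every smooth stable solution $u$ of $-\Delta u=f(u)$ in $\Omega$ with $u=0$ on $\partial\Omega$, the same estimate holds with $y=0$. -/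

import Mathlib

open MeasureTheory Set Topology
open scoped ContDiff Gradient Laplacian

/-- A smooth bounded domain of `ℝⁿ`: a nonempty, connected, bounded open set which, near each of its
boundary points, is the sublevel set `{φ < 0}` of a `C^∞` function `φ` with nonvanishing
differential at that point. -/
structure IsSmoothBoundedDomain {n : ℕ} (Ω : Set (EuclideanSpace ℝ (Fin n))) : Prop where
  isOpen : IsOpen Ω
  isConnected : IsConnected Ω
  isBounded : Bornology.IsBounded Ω
  smooth_boundary : ∀ x₀ ∈ frontier Ω, ∃ U : Set (EuclideanSpace ℝ (Fin n)),
    IsOpen U ∧ x₀ ∈ U ∧ ∃ φ : EuclideanSpace ℝ (Fin n) → ℝ,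
      ContDiffOn ℝ ∞ φ U ∧ fderiv ℝ φ x₀ ≠ 0 ∧ ∀ x ∈ U, (x ∈ Ω ↔ φ x < 0)

/-- `u ∈ C^∞(Ω̄)` solves `-Δu = f(u)` in `Ω`. No boundary condition is imposed. -/
structure IsSmoothSolution {n : ℕ} (Ω : Set (EuclideanSpace ℝ (Fin n))) (f : ℝ → ℝ)
    (u : EuclideanSpace ℝ (Fin n) → ℝ) : Prop where
  smooth : ContDiffOn ℝ ∞ u (closure Ω)
  equation : ∀ x ∈ Ω, -(Δ u) x = f (u x)

/-- Stability of `u`: `∫_Ω f'(u) ξ² ≤ ∫_Ω |∇ξ|²` for all `ξ ∈ C¹(Ω̄)` vanishing on `∂Ω`. -/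
def IsStable {n : ℕ} (Ω : Set (EuclideanSpace ℝ (Fin n))) (f : ℝ → ℝ)
    (u : EuclideanSpace ℝ (Fin n) → ℝ) : Prop :=
  ∀ ξ : EuclideanSpace ℝ (Fin n) → ℝ, ContDiffOn ℝ 1 ξ (closure Ω) →
    (∀ x ∈ frontier Ω, ξ x = 0) →
    ∫ x in Ω, deriv f (u x) * ξ x ^ 2 ≤ ∫ x in Ω, ‖∇ ξ x‖ ^ 2

/-- `K_δ = {x ∈ Ω : dist(x, ∂Ω) ≥ δ}`. -/
def innerSet {n : ℕ} (Ω : Set (EuclideanSpace ℝ (Fin n))) (δ : ℝ) :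
    Set (EuclideanSpace ℝ (Fin n)) :=
  {x ∈ Ω | δ ≤ Metric.infDist x (frontier Ω)}

/-- `∫_Ω |∇u|² |x - y|^{-α} dx` is finite and at most `C ‖∇u‖²_{L²(Ω ∖ K_δ)}`. -/
def WeightedGradientBound {n : ℕ} (Ω : Set (EuclideanSpace ℝ (Fin n))) (α δ C : ℝ)
    (u : EuclideanSpace ℝ (Fin n) → ℝ) (y : EuclideanSpace ℝ (Fin n)) : Prop :=
  IntegrableOn (fun x => ‖∇ u x‖ ^ 2 * ‖x - y‖ ^ (-α)) Ω ∧
    ∫ x in Ω, ‖∇ u x‖ ^ 2 * ‖x - y‖ ^ (-α) ≤ C * ∫ x in Ω \ innerSet Ω δ, ‖∇ u x‖ ^ 2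

/-!
Write `p = ∇u`, `D = D²u`, `z = x - y`, and let `|z|_ε² = |z|² + ε²` regularize the distance to `y`.
The proof tests stability with `η |∇u|`, which turns the stability inequality into the
Sternberg–Zumbrun inequality
`∫ (|D|² - |∇|∇u||²) η² ≤ ∫ |∇u|² |∇η|²`,
in which the potential `f'(u)` no longer occurs. As `|∇u|` is not `C¹` at critical points, the
test function is `η √(|∇u|² + s²)`, and `s → 0` at the end (`stability_of_jacobi`,
`IsStableWithPotential.integral_regHess_le`). The choice `η = |z|_ε^{(2-α)/2} ζ`, with a cutoff `ζ`,
makes the right side `(α - 2)² / 4 · ∫ |∇u|² |z|_ε^{-α} ζ²` plus terms that live where `∇ζ ≠ 0`,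
that is, in `Ω \ K_δ` and away from `y`. So the estimate follows by absorption, and by Fatou's lemma
as `ε → 0`, from any bound of `∫ |∇u|² |z|_ε^{-α} ζ²` by `κ` times the left side, up to such terms,
with `κ (α - 2)² / 4 < 1` (`exists_weightedGradientBound_of_le`).

In a general domain `κ = (n - 1) / (n - 1 - α)²`. This is a Hardy inequality on the level sets of `u`:
the divergence theorem for `ζ² |z|_ε^{-α} V`, where `V = |p|² z - (z·p) p` is `|∇u|²` times the
tangential part of `z`, and `div V = (n - 1) |p|² + z·Dp - (z·p) tr D`. The last two terms are
tangential derivative of `|∇u|` and mean curvature of the level set, and linear algebra bounds them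
by `√(n - 1) |z| |p| (|D|² - |∇|∇u||²)^{1/2}` (`sq_sub_trace_le`, `exists_hardy_on_level_sets`).

In a ball with zero boundary values `u` is radial, so that `V = 0` for `y = 0`. Then `div V = 0`, and
the same linear algebra gives `(n - 1) |∇u|² ≤ |x|² (|D|² - |∇|∇u||²)`, so `κ = 1 / (n - 1)`.
For the radial symmetry let `w = x_i ∂_j u - x_j ∂_i u`. It solves the linearized equation and
vanishes on the boundary, so it has zero energy. Testing stability with a perturbation
of `|w|` by `ε φ`, where `φ` is a cutoff, bounds the Dirichlet integral of `log (w² + 2ε²)` on compact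
subsets uniformly in `ε` (`exists_log_estimate`). But `w` is the derivative of `u` along the orbits of
rotations, which are closed, so it vanishes somewhere on each orbit, and
`∫ log (1 + w² / (2ε²))` is bounded uniformly in `ε` (`integral_log_le`). Letting `ε → 0` gives
`w = 0` (`angDeriv_eq_zero`). This replaces the usual argument by the simplicity of the first
eigenvalue, which would need the strong maximum principle.
-/

/-! ### Partial derivatives and integration by parts -/

/-- The `i`-th partial derivative of a function on `ℝⁿ`. -/
noncomputable def pd {n : ℕ} (i : Fin n) (F : EuclideanSpace ℝ (Fin n) → ℝ)
    (x : EuclideanSpace ℝ (Fin n)) : ℝ :=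
  fderiv ℝ F x (EuclideanSpace.single i 1)

section PartialDerivatives

variable {n : ℕ} {i j : Fin n} {F G : EuclideanSpace ℝ (Fin n) → ℝ}
  {x : EuclideanSpace ℝ (Fin n)} {Ω : Set (EuclideanSpace ℝ (Fin n))}

theorem pd_add (hF : DifferentiableAt ℝ F x) (hG : DifferentiableAt ℝ G x) :
    pd i (fun x => F x + G x) x = pd i F x + pd i G x := by
  simp [pd, fderiv_fun_add hF hG]

theorem pd_sub (hF : DifferentiableAt ℝ F x) (hG : DifferentiableAt ℝ G x) :
    pd i (fun x => F x - G x) x = pd i F x - pd i G x := by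
  simp [pd, fderiv_fun_sub hF hG]

theorem pd_neg : pd i (fun x => -F x) x = -pd i F x := by
  simp [pd, fderiv_fun_neg]

theorem pd_mul (hF : DifferentiableAt ℝ F x) (hG : DifferentiableAt ℝ G x) :
    pd i (fun x => F x * G x) x = pd i F x * G x + F x * pd i G x := by
  simp [pd, fderiv_fun_mul hF hG]; ring

theorem pd_sum {ι : Type*} [Fintype ι] {H : ι → EuclideanSpace ℝ (Fin n) → ℝ}
    (hH : ∀ k, DifferentiableAt ℝ (H k) x) :
    pd i (fun x => ∑ k, H k x) x = ∑ k, pd i (H k) x := by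
  simp [pd, fderiv_fun_sum (u := Finset.univ) (fun k _ => hH k)]

theorem pd_const (a : ℝ) : pd i (fun _ => a) x = 0 := by
  simp [pd]

theorem pd_comp {φ : ℝ → ℝ} {φ' : ℝ} (hφ : HasDerivAt φ φ' (F x)) (hF : DifferentiableAt ℝ F x) :
    pd i (fun x => φ (F x)) x = φ' * pd i F x := by
  have := (hφ.comp_hasFDerivAt x hF.hasFDerivAt).fderiv
  simp only [Function.comp_def] at this
  simp [pd, this]

theorem pd_sq (hF : DifferentiableAt ℝ F x) :
    pd i (fun x => F x ^ 2) x = 2 * F x * pd i F x := by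
  have h : HasDerivAt (fun t : ℝ => t ^ 2) (2 * F x) (F x) := by
    simpa using hasDerivAt_pow 2 (F x)
  exact pd_comp h hF

theorem pd_coord : pd i (fun x : EuclideanSpace ℝ (Fin n) => x j) x = if i = j then 1 else 0 := by
  have h : fderiv ℝ (fun x : EuclideanSpace ℝ (Fin n) => x j) x =
      (EuclideanSpace.proj j : EuclideanSpace ℝ (Fin n) →L[ℝ] ℝ) :=
    (EuclideanSpace.proj j : EuclideanSpace ℝ (Fin n) →L[ℝ] ℝ).hasFDerivAt.fderiv
  simp [pd, h, eq_comm]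

theorem pd_congr (h : F =ᶠ[𝓝 x] G) : pd i F x = pd i G x := by
  simp [pd, h.fderiv_eq]

theorem norm_gradient_sq (F : EuclideanSpace ℝ (Fin n) → ℝ) (x : EuclideanSpace ℝ (Fin n)) :
    ‖∇ F x‖ ^ 2 = ∑ i, pd i F x ^ 2 := by
  rw [EuclideanSpace.norm_sq_eq]
  refine Finset.sum_congr rfl fun i _ => ?_
  have : (∇ F x) i = pd i F x := by
    rw [pd, ← toDual_gradient, InnerProductSpace.toDual_apply_apply,
      EuclideanSpace.inner_single_right]
    simp
  rw [this, Real.norm_eq_abs, sq_abs]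

theorem ContDiffOn.pd (hΩ : IsOpen Ω) (hF : ContDiffOn ℝ ∞ F Ω) : ContDiffOn ℝ ∞ (pd i F) Ω := by
  have h : ContDiffOn ℝ ∞ (fderiv ℝ F) Ω := hF.fderiv_of_isOpen hΩ (by simp)
  exact h.clm_apply contDiffOn_const

theorem ContDiff.pd (hF : ContDiff ℝ ∞ F) : ContDiff ℝ ∞ (pd i F) := by
  have h : ContDiff ℝ ∞ (fderiv ℝ F) := hF.fderiv_right (by simp)
  exact h.clm_apply contDiff_const

theorem ContDiffOn.differentiableAt_of_isOpen (hF : ContDiffOn ℝ ∞ F Ω) (hΩ : IsOpen Ω)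
    (hx : x ∈ Ω) : DifferentiableAt ℝ F x :=
  (hF.contDiffAt (hΩ.mem_nhds hx)).differentiableAt (by simp)

theorem pd_pd_eq (hΩ : IsOpen Ω) (hF : ContDiffOn ℝ ∞ F Ω) (hx : x ∈ Ω) :
    pd i (pd j F) x =
      fderiv ℝ (fderiv ℝ F) x (EuclideanSpace.single i 1) (EuclideanSpace.single j 1) := by
  have h : ContDiffOn ℝ ∞ (fderiv ℝ F) Ω := hF.fderiv_of_isOpen hΩ (by simp)
  have h' : DifferentiableAt ℝ (fderiv ℝ F) x :=
    (h.contDiffAt (hΩ.mem_nhds hx)).differentiableAt (by simp)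
  have := (h'.hasFDerivAt.clm_apply (hasFDerivAt_const (EuclideanSpace.single j (1 : ℝ)) x)).fderiv
  unfold pd
  rw [this]
  simp

theorem pd_comm (hΩ : IsOpen Ω) (hF : ContDiffOn ℝ ∞ F Ω) (hx : x ∈ Ω) :
    pd i (pd j F) x = pd j (pd i F) x := by
  rw [pd_pd_eq hΩ hF hx, pd_pd_eq hΩ hF hx]
  exact (hF.contDiffAt (hΩ.mem_nhds hx)).isSymmSndFDerivAt
    (by simpa using WithTop.coe_le_coe.2 (le_top : (2 : ℕ∞) ≤ ⊤)) _ _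

theorem laplacian_eq_sum_pd (hΩ : IsOpen Ω) (hF : ContDiffOn ℝ ∞ F Ω) (hx : x ∈ Ω) :
    Δ F x = ∑ i, pd i (pd i F) x := by
  rw [InnerProductSpace.laplacian_eq_iteratedFDeriv_orthonormalBasis F
    (EuclideanSpace.basisFun (Fin n) ℝ)]
  refine Finset.sum_congr rfl fun i _ => ?_
  rw [pd_pd_eq hΩ hF hx, iteratedFDeriv_two_apply]
  simp

end PartialDerivatives

section Cutoff

/-- A smooth function with compact support inside `Ω`. -/
structure IsCutoff {n : ℕ} (Ω : Set (EuclideanSpace ℝ (Fin n)))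
    (η : EuclideanSpace ℝ (Fin n) → ℝ) : Prop where
  contDiff : ContDiff ℝ ∞ η
  hasCompactSupport : HasCompactSupport η
  tsupport_subset : tsupport η ⊆ Ω

variable {n : ℕ} {i : Fin n} {F η : EuclideanSpace ℝ (Fin n) → ℝ}
  {Ω : Set (EuclideanSpace ℝ (Fin n))}

theorem tsupport_pd_subset : tsupport (pd i η) ⊆ tsupport η := by
  refine (closure_mono ?_).trans (tsupport_fderiv_subset ℝ (f := η))
  · intro x hx hx'
    exact hx (by simp [pd, hx'])

theorem IsCutoff.pd (hη : IsCutoff Ω η) : IsCutoff Ω (pd i η) where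
  contDiff := hη.contDiff.pd
  hasCompactSupport := hη.hasCompactSupport.of_isClosed_subset (isClosed_tsupport _)
    tsupport_pd_subset
  tsupport_subset := tsupport_pd_subset.trans hη.tsupport_subset

theorem IsCutoff.contDiff_mul (hη : IsCutoff Ω η) (hΩ : IsOpen Ω) (hF : ContDiffOn ℝ ∞ F Ω) :
    ContDiff ℝ ∞ (fun x => η x * F x) := by
  rw [contDiff_iff_contDiffAt]
  intro x
  by_cases hx : x ∈ tsupport η
  · exact hη.contDiff.contDiffAt.mul (hF.contDiffAt (hΩ.mem_nhds (hη.tsupport_subset hx)))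
  · have : (fun x => η x * F x) =ᶠ[𝓝 x] fun _ => 0 := by
      filter_upwards [notMem_tsupport_iff_eventuallyEq.1 hx] with y hy
      simp [hy]
    exact contDiffAt_const.congr_of_eventuallyEq this

theorem IsCutoff.mul (hη : IsCutoff Ω η) (hΩ : IsOpen Ω) (hF : ContDiffOn ℝ ∞ F Ω) :
    IsCutoff Ω (fun x => η x * F x) where
  contDiff := hη.contDiff_mul hΩ hF
  hasCompactSupport := hη.hasCompactSupport.mul_right
  tsupport_subset := (tsupport_mul_subset_left (f := η) (g := F)).trans hη.tsupport_subset

theorem IsCutoff.integrable_mul (hη : IsCutoff Ω η) (hΩ : IsOpen Ω) (hF : ContinuousOn F Ω) :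
    Integrable (fun x => η x * F x) := by
  refine Continuous.integrable_of_hasCompactSupport ?_ hη.hasCompactSupport.mul_right
  rw [continuous_iff_continuousAt]
  intro x
  by_cases hx : x ∈ tsupport η
  · exact hη.contDiff.continuous.continuousAt.mul
      (hF.continuousAt (hΩ.mem_nhds (hη.tsupport_subset hx)))
  · have : (fun x => η x * F x) =ᶠ[𝓝 x] fun _ => 0 := by
      filter_upwards [notMem_tsupport_iff_eventuallyEq.1 hx] with y hy
      simp [hy]
    exact continuousAt_const.congr this.symm

theorem pd_eq_zero_of_notMem_tsupport {x : EuclideanSpace ℝ (Fin n)} (hx : x ∉ tsupport η) :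
    pd i η x = 0 :=
  image_eq_zero_of_notMem_tsupport fun h => hx (tsupport_pd_subset h)

theorem IsCutoff.integrableOn (hη : IsCutoff Ω η) (hΩ : IsOpen Ω) (hF : ContinuousOn F Ω)
    (h0 : ∀ x ∉ tsupport η, F x = 0) : IntegrableOn F Ω := by
  have h : IntegrableOn F (tsupport η) :=
    (hF.mono hη.tsupport_subset).integrableOn_compact hη.hasCompactSupport
  exact h.of_forall_sdiff_eq_zero hΩ.measurableSet fun x hx => h0 x hx.2

theorem IsCutoff.setIntegral_eq (hη : IsCutoff Ω η) (F : EuclideanSpace ℝ (Fin n) → ℝ) :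
    ∫ x in Ω, η x * F x = ∫ x, η x * F x := by
  refine setIntegral_eq_integral_of_forall_compl_eq_zero fun x hx => ?_
  rw [image_eq_zero_of_notMem_tsupport fun h => hx (hη.tsupport_subset h), zero_mul]

/-- Integration by parts against a cutoff function. -/
theorem IsCutoff.integral_mul_pd (hη : IsCutoff Ω η) (hΩ : IsOpen Ω) (hF : ContDiffOn ℝ ∞ F Ω)
    (i : Fin n) : ∫ x in Ω, (_root_.pd i η x * F x + η x * _root_.pd i F x) = 0 := by
  have h1 := (hη.pd (i := i)).integrable_mul hΩ hF.continuousOn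
  have h2 := hη.integrable_mul hΩ (hF.pd hΩ (i := i)).continuousOn
  rw [integral_add h1.integrableOn h2.integrableOn, hη.pd.setIntegral_eq, hη.setIntegral_eq]
  have := integral_mul_fderiv_eq_neg_fderiv_mul_of_integrable (μ := volume) (f := η) (g := F)
    (v := EuclideanSpace.single i 1) h1 h2 (hη.integrable_mul hΩ hF.continuousOn)
    (fun x _ => hη.contDiff.differentiable (by simp) x)
    (fun x hx => hF.differentiableAt_of_isOpen hΩ (hη.tsupport_subset hx))
  simp only [_root_.pd]
  rw [this]; ring

end Cutoff

/-! ### Stability tested with Jacobi fields -/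

section Stability

variable {n : ℕ} {Ω : Set (EuclideanSpace ℝ (Fin n))} {c η : EuclideanSpace ℝ (Fin n) → ℝ}

/-- Caccioppoli identity: a solution `J` of `-ΔJ = cJ` tested against `η² J`. -/
theorem integral_jacobi_eq_zero (hΩ : IsOpen Ω) (hc : ContinuousOn c Ω) (hη : IsCutoff Ω η)
    {J : EuclideanSpace ℝ (Fin n) → ℝ} (hJ : ContDiffOn ℝ ∞ J Ω)
    (hJc : ∀ x ∈ Ω, ∑ i, pd i (pd i J) x = -(c x * J x)) :
    IntegrableOn (fun x => 2 * η x * ∑ i, pd i η x * (J x * pd i J x)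
      + η x ^ 2 * ∑ i, pd i J x ^ 2 - c x * (η x ^ 2 * J x ^ 2)) Ω ∧
    ∫ x in Ω, (2 * η x * ∑ i, pd i η x * (J x * pd i J x)
      + η x ^ 2 * ∑ i, pd i J x ^ 2 - c x * (η x ^ 2 * J x ^ 2)) = 0 := by
  have hηc : ContinuousOn η Ω := hη.contDiff.continuous.continuousOn
  have hpη : ∀ i, ContinuousOn (pd i η) Ω := fun i => hη.pd.contDiff.continuous.continuousOn
  have hJ' := hJ.continuousOn
  have hpJ : ∀ i, ContDiffOn ℝ ∞ (pd i J) Ω := fun i => hJ.pd hΩ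
  have hpJ' : ∀ i, ContinuousOn (pd i J) Ω := fun i => (hpJ i).continuousOn
  refine ⟨hη.integrableOn hΩ (by fun_prop) fun x hx => ?_, ?_⟩
  · simp [image_eq_zero_of_notMem_tsupport hx]
  have hη2 : IsCutoff Ω (fun x => η x * η x) := hη.mul hΩ hη.contDiff.contDiffOn
  have hF : ∀ i, ContDiffOn ℝ ∞ (fun x => J x * pd i J x) Ω := fun i => hJ.mul (hpJ i)
  have key := Finset.sum_congr (rfl : (Finset.univ : Finset (Fin n)) = Finset.univ)
    fun i _ => hη2.integral_mul_pd hΩ (hF i) i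
  rw [Finset.sum_const_zero, ← integral_finsetSum] at key
  · rw [← key]
    refine setIntegral_congr_fun hΩ.measurableSet fun x hx => ?_
    have hηd : DifferentiableAt ℝ η x := hη.contDiff.differentiable (by simp) x
    have hJd := hJ.differentiableAt_of_isOpen hΩ hx
    have e1 : ∀ i, pd i (fun x => η x * η x) x = 2 * η x * pd i η x := fun i => by
      rw [pd_mul hηd hηd]; ring
    have e2 : ∀ i, pd i (fun x => J x * pd i J x) x = pd i J x ^ 2 + J x * pd i (pd i J) x :=
      fun i => by rw [pd_mul hJd ((hpJ i).differentiableAt_of_isOpen hΩ hx)]; ring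
    simp only [e1, e2, mul_add, Finset.sum_add_distrib]
    have e3 : ∑ i, η x * η x * (J x * pd i (pd i J) x) = -(c x * (η x ^ 2 * J x ^ 2)) := by
      rw [← Finset.mul_sum, ← Finset.mul_sum, hJc x hx]; ring
    rw [e3, Finset.mul_sum, Finset.mul_sum, sub_eq_add_neg, ← add_assoc]
    congr 2
    · exact Finset.sum_congr rfl fun i _ => by ring
    · exact Finset.sum_congr rfl fun i _ => by ring
  · intro i _
    exact ((hη2.pd.integrable_mul hΩ (hF i).continuousOn).add
      (hη2.integrable_mul hΩ ((hF i).pd hΩ).continuousOn)).integrableOn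

theorem pd_sqrt {i : Fin n} {P : EuclideanSpace ℝ (Fin n) → ℝ} {x : EuclideanSpace ℝ (Fin n)}
    (hP : DifferentiableAt ℝ P x) (h0 : 0 < P x) :
    pd i (fun x => √(P x)) x = pd i P x / 2 / √(P x) := by
  rw [pd_comp (Real.hasDerivAt_sqrt h0.ne') hP]
  field_simp

/-- Sternberg–Zumbrun inequality for a family `J` of Jacobi fields: the result of testing the
stability of `-Δ - c` with `η √(∑ J_k² + ψ)`, where `ψ > 0` keeps the root smooth. -/
theorem stability_of_jacobi {ι : Type*} [Fintype ι] (hΩ : IsOpen Ω) (hc : ContinuousOn c Ω)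
    (hstab : ∀ ξ, IsCutoff Ω ξ → ∫ x in Ω, c x * ξ x ^ 2 ≤ ∫ x in Ω, ∑ i, pd i ξ x ^ 2)
    (hη : IsCutoff Ω η) {J : ι → EuclideanSpace ℝ (Fin n) → ℝ}
    (hJ : ∀ k, ContDiffOn ℝ ∞ (J k) Ω)
    (hJc : ∀ k, ∀ x ∈ Ω, ∑ i, pd i (pd i (J k)) x = -(c x * J k x))
    {ψ : EuclideanSpace ℝ (Fin n) → ℝ} (hψ : ContDiffOn ℝ ∞ ψ Ω) (hψ0 : ∀ x ∈ Ω, 0 < ψ x) :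
    0 ≤ ∫ x in Ω, (η x ^ 2 * ∑ i, (∑ k, J k x * pd i (J k) x + pd i ψ x / 2) ^ 2
          / (∑ k, J k x ^ 2 + ψ x)
        + (∑ k, J k x ^ 2 + ψ x) * ∑ i, pd i η x ^ 2
        + η x * ∑ i, pd i η x * pd i ψ x - c x * (η x ^ 2 * ψ x)
        - η x ^ 2 * ∑ k, ∑ i, pd i (J k) x ^ 2) := by
  have hηc : ContinuousOn η Ω := hη.contDiff.continuous.continuousOn
  have hP0 : ∀ x ∈ Ω, 0 < ∑ k, J k x ^ 2 + ψ x := fun x hx => by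
    have := hψ0 x hx
    positivity
  have hP : ContDiffOn ℝ ∞ (fun x => ∑ k, J k x ^ 2 + ψ x) Ω :=
    (ContDiffOn.sum fun k _ => (hJ k).pow 2).add hψ
  have hsP : ContDiffOn ℝ ∞ (fun x => √(∑ k, J k x ^ 2 + ψ x)) Ω :=
    hP.sqrt fun x hx => (hP0 x hx).ne'
  have hξ : IsCutoff Ω (fun x => η x * √(∑ k, J k x ^ 2 + ψ x)) := hη.mul hΩ hsP
  have hs := hstab _ hξ
  have hpP : ∀ i, ∀ x ∈ Ω, pd i (fun x => ∑ k, J k x ^ 2 + ψ x) x / 2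
      = ∑ k, J k x * pd i (J k) x + pd i ψ x / 2 := by
    intro i x hx
    have hJd := fun k => (hJ k).differentiableAt_of_isOpen hΩ hx
    have hJ2 : ∀ k, DifferentiableAt ℝ (fun x => J k x ^ 2) x := fun k => (hJd k).pow 2
    rw [pd_add (DifferentiableAt.fun_sum fun k _ => hJ2 k)
      (hψ.differentiableAt_of_isOpen hΩ hx), pd_sum hJ2]
    simp only [pd_sq (hJd _), add_div, Finset.sum_div]
    congr 1
    exact Finset.sum_congr rfl fun k _ => by ring
  have hξc := hξ.contDiff.continuous.continuousOn (s := Ω)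
  have hpξc : ∀ i, ContinuousOn (pd i (fun x => η x * √(∑ k, J k x ^ 2 + ψ x))) Ω :=
    fun i => hξ.pd.contDiff.continuous.continuousOn
  have i1 : IntegrableOn (fun x => c x * (η x * √(∑ k, J k x ^ 2 + ψ x)) ^ 2) Ω :=
    hξ.integrableOn hΩ (by fun_prop) fun x hx => by
      have := image_eq_zero_of_notMem_tsupport hx
      rw [this]
      simp
  have i2 : IntegrableOn (fun x => ∑ i, pd i (fun x => η x * √(∑ k, J k x ^ 2 + ψ x)) x ^ 2) Ω :=
    hξ.integrableOn hΩ (by fun_prop) fun x hx => by simp [pd_eq_zero_of_notMem_tsupport hx]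
  have hcacc := fun k => integral_jacobi_eq_zero hΩ hc hη (hJ k) (hJc k)
  have h0 : 0 ≤ ∫ x in Ω, ((∑ i, pd i (fun x => η x * √(∑ k, J k x ^ 2 + ψ x)) x ^ 2
      - c x * (η x * √(∑ k, J k x ^ 2 + ψ x)) ^ 2)
      - ∑ k, (2 * η x * ∑ i, pd i η x * (J k x * pd i (J k) x)
      + η x ^ 2 * ∑ i, pd i (J k) x ^ 2 - c x * (η x ^ 2 * J k x ^ 2))) := by
    have i12 := i2.sub i1
    simp only [Pi.sub_def] at i12
    rw [integral_sub i12 (integrable_finsetSum Finset.univ fun k _ => (hcacc k).1),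
      integral_sub i2 i1, integral_finsetSum Finset.univ fun k _ => (hcacc k).1]
    simp only [fun k => (hcacc k).2]
    simpa using hs
  refine h0.trans_eq (setIntegral_congr_fun hΩ.measurableSet fun x hx => ?_)
  have hηd : DifferentiableAt ℝ η x := hη.contDiff.differentiable (by simp) x
  have hPd := hP.differentiableAt_of_isOpen hΩ hx
  have e1 : ∀ i, pd i (fun x => η x * √(∑ k, J k x ^ 2 + ψ x)) x ^ 2
      = (∑ k, J k x ^ 2 + ψ x) * pd i η x ^ 2
        + 2 * (η x * (pd i η x * (∑ k, J k x * pd i (J k) x)))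
        + η x * (pd i η x * pd i ψ x)
        + η x ^ 2 * ((∑ k, J k x * pd i (J k) x + pd i ψ x / 2) ^ 2
          / (∑ k, J k x ^ 2 + ψ x)) := by
    intro i
    rw [pd_mul hηd (hsP.differentiableAt_of_isOpen hΩ hx), pd_sqrt hPd (hP0 x hx), hpP i x hx]
    have hp := hP0 x hx
    have hq := Real.sq_sqrt hp.le
    have hq0 := Real.sqrt_pos.2 hp
    generalize √(∑ k, J k x ^ 2 + ψ x) = q at *
    rw [← hq]
    field_simp
    ring
  have e2 : ∑ k, (2 * η x * ∑ i, pd i η x * (J k x * pd i (J k) x)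
      + η x ^ 2 * ∑ i, pd i (J k) x ^ 2 - c x * (η x ^ 2 * J k x ^ 2))
      = ∑ i, 2 * (η x * (pd i η x * (∑ k, J k x * pd i (J k) x)))
        + η x ^ 2 * ∑ k, ∑ i, pd i (J k) x ^ 2 - c x * (η x ^ 2 * ∑ k, J k x ^ 2) := by
    simp only [Finset.sum_sub_distrib, Finset.sum_add_distrib, Finset.mul_sum]
    congr 2
    rw [Finset.sum_comm]
    exact Finset.sum_congr rfl fun i _ => Finset.sum_congr rfl fun k _ => by ring
  simp only [e1, e2]
  rw [mul_pow, Real.sq_sqrt (hP0 x hx).le]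
  simp only [Finset.sum_add_distrib, ← Finset.mul_sum]
  ring

end Stability

/-! ### Linear algebra of the Hessian -/

section LinearAlgebra

variable {n : ℕ}

/-- The trace inequality `(tr B)² ≤ (n - 1) |B|²` for the compression `B` of a symmetric matrix `D`
to the hyperplane orthogonal to the unit vector `ν`, in terms of `D` and `d = Dν`. -/
theorem trace_compression_sq_le (hn : 2 ≤ n) {D : Fin n → Fin n → ℝ} (hD : ∀ i j, D i j = D j i)
    {ν d : Fin n → ℝ} (hν : ∑ i, ν i ^ 2 = 1) (hd : ∀ i, d i = ∑ j, D i j * ν j) :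
    (∑ i, D i i - ∑ i, ν i * d i) ^ 2 ≤
      (n - 1) * (∑ i, ∑ j, D i j ^ 2 - 2 * ∑ i, d i ^ 2 + (∑ i, ν i * d i) ^ 2) := by
  set b := ∑ i, ν i * d i with hb
  set t := ∑ i, D i i with ht
  set F := ∑ i, ∑ j, D i j ^ 2 with hF
  set a := ∑ i, d i ^ 2 with ha
  have hn1 : (1 : ℝ) ≤ n - 1 := by
    have : (2 : ℝ) ≤ n := by exact_mod_cast hn
    linarith
  -- `l` is the mean eigenvalue of the compression
  set l := (t - b) / (n - 1) with hl
  have hpos : 0 ≤ ∑ i, ∑ j, (D i j - ν i * d j - d i * ν j + (b + l) * (ν i * ν j)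
      - l * if i = j then 1 else 0) ^ 2 := by positivity
  have hexp : ∀ i, ∑ j, (D i j - ν i * d j - d i * ν j + (b + l) * (ν i * ν j)
      - l * if i = j then 1 else 0) ^ 2
      = ∑ j, D i j ^ 2 + ν i ^ 2 * a + d i ^ 2 + (b + l) ^ 2 * ν i ^ 2 + l ^ 2
        - 2 * ν i * ∑ j, D i j * d j - 2 * d i ^ 2 + 2 * (b + l) * (ν i * d i)
        - 2 * l * D i i + 2 * (ν i * d i) * b - 2 * (b + l) * (ν i ^ 2 * b)
        + 2 * l * (ν i * d i) - 2 * (b + l) * (ν i * d i) + 2 * l * (ν i * d i)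
        - 2 * l * (b + l) * ν i ^ 2 := by
    intro i
    have e : ∀ j, (D i j - ν i * d j - d i * ν j + (b + l) * (ν i * ν j)
        - l * if i = j then 1 else 0) ^ 2
        = D i j ^ 2 + ν i ^ 2 * d j ^ 2 + d i ^ 2 * ν j ^ 2 + (b + l) ^ 2 * ν i ^ 2 * ν j ^ 2
          - 2 * ν i * (D i j * d j) - 2 * d i * (D i j * ν j) + 2 * (b + l) * ν i * (D i j * ν j)
          + 2 * (ν i * d i) * (ν j * d j) - 2 * (b + l) * ν i ^ 2 * (ν j * d j)
          - 2 * (b + l) * (ν i * d i) * ν j ^ 2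
          + (if i = j then l ^ 2 - 2 * l * D i j + 2 * l * (ν i * d j) + 2 * l * (d i * ν j)
            - 2 * l * (b + l) * (ν i * ν j) else 0) := by
      intro j
      split_ifs <;> ring
    simp only [e, Finset.sum_add_distrib, Finset.sum_sub_distrib, ← Finset.mul_sum, ← hd, hν,
      ← hb, ← ha, Finset.sum_ite_eq, Finset.mem_univ, if_true]
    ring
  simp only [hexp, Finset.sum_add_distrib, Finset.sum_sub_distrib, ← Finset.mul_sum,
    ← Finset.sum_mul, hν, ← hb, ← ha, ← hF, ← ht] at hpos
  have h2 : ∑ i, 2 * ν i * ∑ j, D i j * d j = 2 * a := by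
    simp only [Finset.mul_sum]
    rw [Finset.sum_comm, ha, Finset.mul_sum]
    refine Finset.sum_congr rfl fun j _ => ?_
    rw [sq]
    nth_rw 3 [hd j]
    rw [Finset.mul_sum, Finset.mul_sum]
    exact Finset.sum_congr rfl fun i _ => by rw [hD i j]; ring
  have h3 : ∑ _i : Fin n, l ^ 2 = n * l ^ 2 := by simp
  rw [h2, h3] at hpos
  have hl' : l * (n - 1) = t - b := by rw [hl]; field_simp
  have key : 0 ≤ F - 2 * a + b ^ 2 - l * (t - b) := by
    have : (n : ℝ) * l ^ 2 = l ^ 2 + l * (t - b) := by rw [← hl']; ring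
    rw [this] at hpos
    nlinarith
  have : (t - b) ^ 2 = (n - 1) * (l * (t - b)) := by rw [← hl']; ring
  rw [this]
  exact mul_le_mul_of_nonneg_left (by linarith) (by linarith)

/-- For a symmetric matrix `D` and a vector `p`, regularized by `s`, the inequality
`(z·Dp - (z·p) tr D)² ≤ (n - 1) |z|² |p|² (|D|² - |Dp|²/(|p|² + s²))`. When `D` is the Hessian of
`u` and `p = ∇u`, the left side is tangential gradient and mean curvature of the level set, and the
last factor the quantity controlled by stability. -/
theorem sq_sub_trace_le (hn : 2 ≤ n) {D : Fin n → Fin n → ℝ} (hD : ∀ i j, D i j = D j i)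
    (p z : Fin n → ℝ) (s : ℝ) :
    (∑ i, z i * ∑ j, D i j * p j - (∑ i, z i * p i) * ∑ i, D i i) ^ 2 ≤
      (n - 1) * (∑ i, z i ^ 2) * (∑ i, p i ^ 2) *
        (∑ i, ∑ j, D i j ^ 2 - (∑ i, (∑ j, D i j * p j) ^ 2) / (∑ i, p i ^ 2 + s ^ 2)) := by
  set G := ∑ i, p i ^ 2 with hG
  have hG0 : 0 ≤ G := by positivity
  rcases hG0.eq_or_lt with h0 | hpos
  · have hp : ∀ i, p i = 0 := fun i => by
      have := (Finset.sum_eq_zero_iff_of_nonneg (fun i _ => sq_nonneg (p i))).1 h0.symm i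
        (Finset.mem_univ i)
      exact pow_eq_zero_iff two_ne_zero |>.1 this
    simp [hp, ← h0]
  set m := √G with hm
  have hm0 : 0 < m := Real.sqrt_pos.2 hpos
  have hmG : m ^ 2 = G := Real.sq_sqrt hpos.le
  set d := fun i => ∑ j, D i j * p j with hd
  have hn1 : (1 : ℝ) ≤ n - 1 := by
    have : (2 : ℝ) ≤ n := by exact_mod_cast hn
    linarith
  have hT := trace_compression_sq_le hn hD (ν := fun i => p i / m) (d := fun i => d i / m)
    (by simp only [div_pow]; rw [← Finset.sum_div, hmG, ← hG]; exact div_self hpos.ne')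
    (fun i => by simp only [hd, Finset.sum_div, mul_div_assoc])
  set t := ∑ i, D i i with ht
  set F := ∑ i, ∑ j, D i j ^ 2 with hF
  set a := ∑ i, d i ^ 2 with ha
  set b := ∑ i, p i * d i with hb
  have e1 : ∑ i, p i / m * (d i / m) = b / G := by
    rw [hb, Finset.sum_div]
    exact Finset.sum_congr rfl fun i _ => by rw [← hmG]; ring
  have e2 : ∑ i, (d i / m) ^ 2 = a / G := by
    rw [ha, Finset.sum_div]
    exact Finset.sum_congr rfl fun i _ => by rw [← hmG]; ring
  rw [e1, e2] at hT
  have hCS : b ^ 2 ≤ G * a := Finset.sum_mul_sq_le_sq_mul_sq _ _ _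
  have ha0 : 0 ≤ a := by positivity
  -- Cauchy–Schwarz removes the vector `z`
  have hz : (∑ i, z i * d i - (∑ i, z i * p i) * t) ^ 2
      ≤ (∑ i, z i ^ 2) * (a - 2 * t * b + t ^ 2 * G) := by
    have h := Finset.sum_mul_sq_le_sq_mul_sq Finset.univ z (fun i => d i - t * p i)
    have e3 : ∑ i, z i * (d i - t * p i) = ∑ i, z i * d i - (∑ i, z i * p i) * t := by
      rw [Finset.sum_mul, ← Finset.sum_sub_distrib]
      exact Finset.sum_congr rfl fun i _ => by ring
    have e4 : ∑ i, (d i - t * p i) ^ 2 = a - 2 * t * b + t ^ 2 * G := by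
      have e : ∀ i, (d i - t * p i) ^ 2 = d i ^ 2 - 2 * t * (p i * d i) + t ^ 2 * p i ^ 2 :=
        fun i => by ring
      simp only [e, Finset.sum_add_distrib, Finset.sum_sub_distrib, ← Finset.mul_sum, ← ha, ← hb,
        ← hG]
    rwa [e3, e4] at h
  have hmain : a - 2 * t * b + t ^ 2 * G ≤ (n - 1) * G * (F - a / G) := by
    have h1 : (a - 2 * t * b + t ^ 2 * G) = G * ((a / G - (b / G) ^ 2) + (t - b / G) ^ 2) := by
      field_simp; ring
    have h2 : 0 ≤ a / G - (b / G) ^ 2 := by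
      have : a / G - (b / G) ^ 2 = (G * a - b ^ 2) / G ^ 2 := by field_simp
      rw [this]; apply div_nonneg (by linarith) (by positivity)
    have h3 : (a / G - (b / G) ^ 2) + (t - b / G) ^ 2 ≤ (n - 1) * (F - a / G) := by
      nlinarith
    rw [h1]
    calc G * _ ≤ G * ((n - 1) * (F - a / G)) := mul_le_mul_of_nonneg_left h3 hpos.le
      _ = _ := by ring
  have hs' : a / (G + s ^ 2) ≤ a / G := by
    apply div_le_div_of_nonneg_left ha0 hpos; nlinarith
  calc _ ≤ (∑ i, z i ^ 2) * (a - 2 * t * b + t ^ 2 * G) := hz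
    _ ≤ (∑ i, z i ^ 2) * ((n - 1) * G * (F - a / (G + s ^ 2))) := by
        refine mul_le_mul_of_nonneg_left (hmain.trans ?_) (by positivity)
        exact mul_le_mul_of_nonneg_left (by linarith) (mul_nonneg (by linarith) hpos.le)
    _ = _ := by ring

theorem regularized_hessian_nonneg {D : Fin n → Fin n → ℝ} (p : Fin n → ℝ) {s : ℝ} (hs : 0 < s) :
    0 ≤ ∑ i, ∑ j, D i j ^ 2 - (∑ i, (∑ j, D i j * p j) ^ 2) / (∑ i, p i ^ 2 + s ^ 2) := by
  have hG0 : 0 ≤ ∑ i, p i ^ 2 := by positivity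
  have h : ∑ i, (∑ j, D i j * p j) ^ 2 ≤ (∑ i, ∑ j, D i j ^ 2) * ∑ i, p i ^ 2 := by
    rw [Finset.sum_mul]
    exact Finset.sum_le_sum fun i _ => Finset.sum_mul_sq_le_sq_mul_sq _ _ _
  rw [sub_nonneg, div_le_iff₀ (by positivity)]
  have h2 : 0 ≤ ∑ i, ∑ j, D i j ^ 2 := by positivity
  nlinarith [mul_nonneg h2 (sq_nonneg s)]

end LinearAlgebra

/-! ### The Sternberg–Zumbrun inequality for the gradient, and cutoffs of a domain -/

section StableGradient

variable {n : ℕ} {Ω : Set (EuclideanSpace ℝ (Fin n))} {u c η : EuclideanSpace ℝ (Fin n) → ℝ}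

/-- The squared length `|∇u|²`, in coordinates. -/
noncomputable def gradSq (u : EuclideanSpace ℝ (Fin n) → ℝ) (x : EuclideanSpace ℝ (Fin n)) : ℝ :=
  ∑ i, pd i u x ^ 2

/-- The quantity `|D²u|² - |D²u ∇u|² / (|∇u|² + s²)`. For `s = 0` and `∇u ≠ 0` it is
`|D²u|² - |∇|∇u||²`; the regularization by `s` makes it continuous at critical points. -/
noncomputable def regHess (u : EuclideanSpace ℝ (Fin n) → ℝ) (s : ℝ)
    (x : EuclideanSpace ℝ (Fin n)) : ℝ :=
  ∑ i, ∑ j, pd i (pd j u) x ^ 2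
    - (∑ i, (∑ j, pd i (pd j u) x * pd j u x) ^ 2) / (∑ i, pd i u x ^ 2 + s ^ 2)

/-- `u` is smooth in `Ω`, its partial derivatives are Jacobi fields of `-Δ - c`, and `-Δ - c` is
nonnegative on functions with compact support in `Ω`. For a stable solution of `-Δu = f(u)` this
holds with `c = f'(u)`. -/
structure IsStableWithPotential (Ω : Set (EuclideanSpace ℝ (Fin n)))
    (u c : EuclideanSpace ℝ (Fin n) → ℝ) : Prop where
  isOpen : IsOpen Ω
  smooth : ContDiffOn ℝ ∞ u Ω
  continuousOn : ContinuousOn c Ω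
  jacobi : ∀ k, ∀ x ∈ Ω, ∑ i, pd i (pd i (pd k u)) x = -(c x * pd k u x)
  stable : ∀ ξ, IsCutoff Ω ξ → ∫ x in Ω, c x * ξ x ^ 2 ≤ ∫ x in Ω, ∑ i, pd i ξ x ^ 2

theorem isStableWithPotential_of_isStable (hΩ : IsOpen Ω) {f : ℝ → ℝ} (hf : ContDiff ℝ 1 f)
    (hu : IsSmoothSolution Ω f u) (hs : IsStable Ω f u) :
    IsStableWithPotential Ω u (fun x => deriv f (u x)) := by
  have hsm : ContDiffOn ℝ ∞ u Ω := hu.smooth.mono subset_closure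
  have hp : ∀ k, ContDiffOn ℝ ∞ (pd k u) Ω := fun k => hsm.pd hΩ
  refine ⟨hΩ, hsm, (hf.continuous_deriv le_rfl).comp_continuousOn hsm.continuousOn, ?_, ?_⟩
  · intro k x hx
    have e1 : ∀ i, pd i (pd i (pd k u)) x = pd k (pd i (pd i u)) x := fun i => by
      have : pd i (pd k u) =ᶠ[𝓝 x] pd k (pd i u) := by
        filter_upwards [hΩ.mem_nhds hx] with y hy using pd_comm hΩ hsm hy
      rw [pd_congr this, pd_comm hΩ (hp i) hx]
    have hud := hsm.differentiableAt_of_isOpen hΩ hx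
    have e2 : (fun y => ∑ i, pd i (pd i u) y) =ᶠ[𝓝 x] fun y => -f (u y) := by
      filter_upwards [hΩ.mem_nhds hx] with y hy
      rw [← laplacian_eq_sum_pd hΩ hsm hy, ← hu.equation y hy]
      simp
    simp only [e1]
    rw [← pd_sum fun i => ((hp i).pd hΩ).differentiableAt_of_isOpen hΩ hx, pd_congr e2, pd_neg,
      pd_comp (hf.differentiable (by simp) (u x)).hasDerivAt hud]
  · intro ξ hξ
    have := hs ξ ((hξ.contDiff.of_le (by simp)).contDiffOn) fun x hx => by
      refine image_eq_zero_of_notMem_tsupport fun h => ?_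
      have := hΩ.inter_frontier_eq
      exact (this ▸ (⟨hξ.tsupport_subset h, hx⟩ : x ∈ Ω ∩ frontier Ω) : x ∈ (∅ : Set _))
    simpa only [norm_gradient_sq] using this

theorem gradSq_nonneg (x : EuclideanSpace ℝ (Fin n)) : 0 ≤ gradSq u x := by
  unfold gradSq; positivity

theorem regHess_nonneg {s : ℝ} (hs : 0 < s) (x : EuclideanSpace ℝ (Fin n)) :
    0 ≤ regHess u s x :=
  regularized_hessian_nonneg (D := fun i j => pd i (pd j u) x) (fun j => pd j u x) hs

theorem continuousOn_gradSq (hΩ : IsOpen Ω) (hu : ContDiffOn ℝ ∞ u Ω) :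
    ContinuousOn (gradSq u) Ω := by
  have : ∀ i, ContinuousOn (pd i u) Ω := fun i => (hu.pd hΩ).continuousOn
  unfold gradSq
  fun_prop

theorem continuousOn_regHess (hΩ : IsOpen Ω) (hu : ContDiffOn ℝ ∞ u Ω) {s : ℝ} (hs : 0 < s) :
    ContinuousOn (regHess u s) Ω := by
  have h1 : ∀ i, ContinuousOn (pd i u) Ω := fun i => (hu.pd hΩ).continuousOn
  have h2 : ∀ i j, ContinuousOn (pd i (pd j u)) Ω := fun i j => ((hu.pd hΩ).pd hΩ).continuousOn
  unfold regHess
  refine ContinuousOn.sub (by fun_prop) (ContinuousOn.div (by fun_prop) (by fun_prop) ?_)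
  intro x _
  positivity

/-- Stability controls `|D²u|² - |∇|∇u||²` by `|∇u|²`. -/
theorem IsStableWithPotential.integral_regHess_le (h : IsStableWithPotential Ω u c)
    (hη : IsCutoff Ω η) {s : ℝ} (hs : 0 < s) :
    ∫ x in Ω, η x ^ 2 * regHess u s x ≤ (∫ x in Ω, gradSq u x * ∑ i, pd i η x ^ 2)
      + s ^ 2 * ∫ x in Ω, (∑ i, pd i η x ^ 2 - c x * η x ^ 2) := by
  have hΩ := h.isOpen
  have hc := h.continuousOn
  have hηc : ContinuousOn η Ω := hη.contDiff.continuous.continuousOn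
  have hpη : ∀ i, ContinuousOn (pd i η) Ω := fun i => hη.pd.contDiff.continuous.continuousOn
  have hG := continuousOn_gradSq hΩ h.smooth
  have hH := continuousOn_regHess hΩ h.smooth hs
  have key := stability_of_jacobi hΩ h.continuousOn h.stable hη
    (J := fun k => pd k u) (fun k => h.smooth.pd hΩ) h.jacobi
    (ψ := fun _ => s ^ 2) contDiffOn_const (fun _ _ => by positivity)
  have i1 : IntegrableOn (fun x => η x ^ 2 * regHess u s x) Ω :=
    hη.integrableOn hΩ (by fun_prop) fun x hx => by simp [image_eq_zero_of_notMem_tsupport hx]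
  have i2 : IntegrableOn (fun x => gradSq u x * ∑ i, pd i η x ^ 2) Ω :=
    hη.integrableOn hΩ (by fun_prop) fun x hx => by simp [pd_eq_zero_of_notMem_tsupport hx]
  have i3 : IntegrableOn (fun x => ∑ i, pd i η x ^ 2 - c x * η x ^ 2) Ω :=
    hη.integrableOn hΩ (by fun_prop) fun x hx => by
      simp [pd_eq_zero_of_notMem_tsupport hx, image_eq_zero_of_notMem_tsupport hx]
  have i4 := i3.const_mul (s ^ 2)
  have i5 := i2.add i4
  simp only [Pi.add_def] at i5
  rw [← integral_const_mul, ← integral_add i2 i4, ← sub_nonneg, ← integral_sub i5 i1]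
  refine key.trans_eq (setIntegral_congr_fun hΩ.measurableSet fun x _ => ?_)
  simp only [pd_const, regHess, gradSq]
  have e1 : ∑ k, ∑ i, pd i (pd k u) x ^ 2 = ∑ i, ∑ j, pd i (pd j u) x ^ 2 := Finset.sum_comm
  have e2 : ∑ i, (∑ k, pd k u x * pd i (pd k u) x + 0 / 2) ^ 2
        / (∑ i, pd i u x ^ 2 + s ^ 2)
      = (∑ i, (∑ j, pd i (pd j u) x * pd j u x) ^ 2) / (∑ i, pd i u x ^ 2 + s ^ 2) := by
    rw [Finset.sum_div]
    refine Finset.sum_congr rfl fun i _ => ?_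
    congr 2
    rw [zero_div, add_zero]
    exact Finset.sum_congr rfl fun k _ => mul_comm _ _
  rw [e1, e2]
  simp
  ring

end StableGradient

section InnerCutoff

variable {n : ℕ} {Ω : Set (EuclideanSpace ℝ (Fin n))} {δ : ℝ} {ζ : EuclideanSpace ℝ (Fin n) → ℝ}

/-- A cutoff `ζ` of `Ω` that is constant equal to `1` near every point of `Ω` other than those of
`Ω \ K_δ` at distance at least `δ / 2` from `K_δ`. -/
structure IsInnerCutoff (Ω : Set (EuclideanSpace ℝ (Fin n))) (δ : ℝ)
    (ζ : EuclideanSpace ℝ (Fin n) → ℝ) : Prop extends IsCutoff Ω ζ where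
  sq_le_one : ∀ x, ζ x ^ 2 ≤ 1
  dichotomy : ∀ x ∈ Ω, (ζ x = 1 ∧ ∀ i, pd i ζ x = 0) ∨
    (x ∈ Ω \ innerSet Ω δ ∧ ∀ y ∈ innerSet Ω δ, δ / 2 ≤ ‖x - y‖)

theorem exists_isInnerCutoff (hΩ : IsOpen Ω) (hb : Bornology.IsBounded Ω) (hδ : 0 < δ) :
    ∃ ζ, IsInnerCutoff Ω δ ζ := by
  set A := {x ∈ Ω | δ / 2 ≤ Metric.infDist x (frontier Ω)} with hA
  have hAeq : A = closure Ω ∩ {x | δ / 2 ≤ Metric.infDist x (frontier Ω)} := by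
    ext x
    refine ⟨fun h => ⟨subset_closure h.1, h.2⟩, fun h => ⟨?_, h.2⟩⟩
    by_contra hx
    have hxf : x ∈ frontier Ω := ⟨h.1, by rwa [hΩ.interior_eq]⟩
    have h2 : δ / 2 ≤ Metric.infDist x (frontier Ω) := h.2
    rw [Metric.infDist_zero_of_mem hxf] at h2
    linarith
  have hcl : IsClosed {x : EuclideanSpace ℝ (Fin n) | δ / 2 ≤ Metric.infDist x (frontier Ω)} :=
    isClosed_le continuous_const (Metric.continuous_infDist_pt _)
  have hAc : IsCompact A := by
    rw [hAeq]
    exact hb.isCompact_closure.inter_right hcl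
  obtain ⟨V, hVo, hAV, hVΩ, hVc⟩ := exists_open_between_and_isCompact_closure hAc hΩ
    (fun x hx => hx.1)
  obtain ⟨ζ, hζ, hζr, hζs, hζ1⟩ := exists_contMDiff_support_eq_eq_one_iff
    (I := modelWithCornersSelf ℝ (EuclideanSpace ℝ (Fin n))) (n := ⊤) hVo hAc.isClosed hAV
  have hsub : tsupport ζ ⊆ closure V := by rw [tsupport, hζs]
  refine ⟨ζ, ⟨⟨hζ.contDiff, hVc.of_isClosed_subset (isClosed_tsupport _) hsub,
    hsub.trans hVΩ⟩, fun x => ?_, fun x hx => ?_⟩⟩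
  · have := hζr (mem_range_self x)
    exact pow_le_one₀ this.1 this.2
  · by_cases h : δ / 2 < Metric.infDist x (frontier Ω)
    · left
      refine ⟨(hζ1 x).1 ⟨hx, h.le⟩, fun i => ?_⟩
      have : ζ =ᶠ[𝓝 x] fun _ => 1 := by
        filter_upwards [hΩ.mem_nhds hx, (isOpen_lt continuous_const
          (Metric.continuous_infDist_pt (frontier Ω))).mem_nhds h] with y hy hy'
        exact (hζ1 y).1 ⟨hy, le_of_lt hy'⟩
      rw [pd_congr this, pd_const]
    · right
      push Not at h
      refine ⟨⟨hx, fun hK => ?_⟩, fun y hy => ?_⟩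
      · have := hK.2
        linarith
      · have h1 := Metric.infDist_le_infDist_add_dist (s := frontier Ω) (x := y) (y := x)
        have h2 := hy.2
        rw [dist_comm, dist_eq_norm] at h1
        linarith

theorem IsCutoff.exists_sum_pd_sq_le (hζ : IsCutoff Ω ζ) : ∃ B, ∀ x, ∑ i, _root_.pd i ζ x ^ 2 ≤ B := by
  have hc : Continuous fun x => ∑ i, _root_.pd i ζ x ^ 2 := by
    have : ∀ i, Continuous (_root_.pd i ζ) := fun i => hζ.pd.contDiff.continuous
    fun_prop
  obtain ⟨B, hB⟩ := hζ.hasCompactSupport.exists_bound_of_continuousOn hc.continuousOn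
  refine ⟨max B 0, fun x => ?_⟩
  by_cases hx : x ∈ tsupport ζ
  · exact (le_abs_self _).trans ((hB x hx).trans (le_max_left _ _))
  · simp [pd_eq_zero_of_notMem_tsupport hx]

end InnerCutoff

/-! ### Regularized weights -/

section Weight

variable {n : ℕ} {Ω : Set (EuclideanSpace ℝ (Fin n))} {y : EuclideanSpace ℝ (Fin n)} {ε : ℝ}

/-- The regularized squared distance `|x - y|² + ε²`. -/
noncomputable def regDistSq (y : EuclideanSpace ℝ (Fin n)) (ε : ℝ)
    (x : EuclideanSpace ℝ (Fin n)) : ℝ :=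
  ∑ i, (x i - y i) ^ 2 + ε ^ 2

theorem sum_sub_sq (x y : EuclideanSpace ℝ (Fin n)) : ∑ i, (x i - y i) ^ 2 = ‖x - y‖ ^ 2 := by
  simp [EuclideanSpace.norm_sq_eq]

theorem regDistSq_pos (hε : 0 < ε) (x : EuclideanSpace ℝ (Fin n)) : 0 < regDistSq y ε x := by
  unfold regDistSq; positivity

theorem contDiff_regDistSq : ContDiff ℝ ∞ (regDistSq y ε) := by
  unfold regDistSq; fun_prop

theorem contDiff_regDistSq_rpow (hε : 0 < ε) (e : ℝ) :
    ContDiff ℝ ∞ (fun x => regDistSq y ε x ^ e) :=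
  contDiff_regDistSq.rpow_const_of_ne fun x => (regDistSq_pos hε x).ne'

theorem pd_coord_sub (i j : Fin n) (x : EuclideanSpace ℝ (Fin n)) :
    pd i (fun x : EuclideanSpace ℝ (Fin n) => x j - y j) x = if i = j then 1 else 0 := by
  rw [pd_sub (by fun_prop) (by fun_prop), pd_coord, pd_const, sub_zero]

theorem pd_regDistSq (i : Fin n) (x : EuclideanSpace ℝ (Fin n)) :
    pd i (regDistSq y ε) x = 2 * (x i - y i) := by
  have h : ∀ j, DifferentiableAt ℝ (fun x : EuclideanSpace ℝ (Fin n) => x j - y j) x :=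
    fun j => by fun_prop
  unfold regDistSq
  rw [pd_add (by fun_prop) (by fun_prop), pd_const, pd_sum fun j => (by fun_prop)]
  simp [pd_sq (h _), pd_coord_sub]

theorem pd_regDistSq_rpow (hε : 0 < ε) (e : ℝ) (i : Fin n) (x : EuclideanSpace ℝ (Fin n)) :
    pd i (fun x => regDistSq y ε x ^ e) x
      = 2 * e * regDistSq y ε x ^ (e - 1) * (x i - y i) := by
  rw [pd_comp (Real.hasDerivAt_rpow_const (Or.inl (regDistSq_pos hε x).ne'))
    (contDiff_regDistSq.differentiable (by simp) x), pd_regDistSq]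
  ring

theorem rpow_le_rpow_add_rpow {a b q : ℝ} (ha : 0 < a) (haq : a ≤ q) (hqb : q ≤ b) (e : ℝ) :
    q ^ e ≤ a ^ e + b ^ e := by
  have hq : 0 < q := ha.trans_le haq
  have hb : 0 < b := hq.trans_le hqb
  rcases le_total 0 e with he | he
  · have := Real.rpow_le_rpow hq.le hqb he
    have := Real.rpow_nonneg ha.le e
    linarith
  · have := Real.rpow_le_rpow_of_nonpos ha haq he
    have := Real.rpow_nonneg hb.le e
    linarith

theorem IsCutoff.regDistSq_rpow_mul {ζ : EuclideanSpace ℝ (Fin n) → ℝ} (hζ : IsCutoff Ω ζ)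
    (hΩ : IsOpen Ω) (hε : 0 < ε) (e : ℝ) : IsCutoff Ω (fun x => regDistSq y ε x ^ e * ζ x) := by
  have := hζ.mul hΩ (contDiff_regDistSq_rpow (y := y) hε e).contDiffOn
  simpa only [mul_comm] using this

/-- The gradient of `|x - y|_ε^{(2-α)/2} ζ` is, up to a factor close to one, at most
`|α - 2|/2 · |x - y|_ε^{-α/2} ζ`, plus a term containing `∇ζ`. -/
theorem sum_pd_weight_mul_cutoff_sq_le {ζ : EuclideanSpace ℝ (Fin n) → ℝ} (hζ : IsCutoff Ω ζ)
    (hε : 0 < ε) (α : ℝ) {τ : ℝ} (hτ : 0 < τ) (x : EuclideanSpace ℝ (Fin n)) :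
    ∑ i, pd i (fun x => regDistSq y ε x ^ ((2 - α) / 4) * ζ x) x ^ 2
      ≤ (1 + τ) * ((α - 2) ^ 2 / 4) * (regDistSq y ε x ^ (-α / 2) * ζ x ^ 2)
        + (1 + 1 / τ) * (regDistSq y ε x ^ ((2 - α) / 2) * ∑ i, pd i ζ x ^ 2) := by
  set e := (2 - α) / 4 with he
  set q := regDistSq y ε x with hq
  have hq0 : 0 < q := regDistSq_pos hε x
  have hsq : ∀ i, pd i (fun x => regDistSq y ε x ^ e * ζ x) x ^ 2
      ≤ (1 + τ) * ((2 * e * q ^ (e - 1) * ζ x) ^ 2 * (x i - y i) ^ 2)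
        + (1 + 1 / τ) * ((q ^ e) ^ 2 * pd i ζ x ^ 2) := by
    intro i
    rw [pd_mul ((contDiff_regDistSq_rpow hε e).differentiable (by simp) x)
      (hζ.contDiff.differentiable (by simp) x), pd_regDistSq_rpow hε, ← hq]
    have : ∀ a b : ℝ, (a + b) ^ 2 ≤ (1 + τ) * a ^ 2 + (1 + 1 / τ) * b ^ 2 := by
      intro a b
      have h := div_nonneg (sq_nonneg (τ * a - b)) hτ.le
      have h2 : (τ * a - b) ^ 2 / τ = τ * a ^ 2 - 2 * a * b + 1 / τ * b ^ 2 := by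
        field_simp
        ring
      nlinarith
    refine (this _ _).trans_eq ?_
    ring
  refine (Finset.sum_le_sum fun i _ => hsq i).trans ?_
  rw [Finset.sum_add_distrib]
  simp only [← Finset.mul_sum]
  have hz : ∑ i, (x i - y i) ^ 2 ≤ q := by
    rw [hq, regDistSq]; linarith [sq_nonneg ε]
  have h1 : (q ^ e) ^ 2 = q ^ ((2 - α) / 2) := by
    rw [← Real.rpow_natCast, ← Real.rpow_mul hq0.le]; congr 1; rw [he]; push_cast; ring
  have h2 : (q ^ (e - 1)) ^ 2 * q = q ^ (-α / 2) := by
    rw [← Real.rpow_natCast, ← Real.rpow_mul hq0.le]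
    nth_rw 2 [← Real.rpow_one q]
    rw [← Real.rpow_add hq0]; congr 1; rw [he]; push_cast; ring
  rw [h1, ← h2]
  refine add_le_add_left ?_ _
  have h3 : (2 * e * q ^ (e - 1) * ζ x) ^ 2 * ∑ i, (x i - y i) ^ 2
      ≤ (2 * e * q ^ (e - 1) * ζ x) ^ 2 * q := mul_le_mul_of_nonneg_left hz (sq_nonneg _)
  calc _ ≤ (1 + τ) * ((2 * e * q ^ (e - 1) * ζ x) ^ 2 * q) :=
        mul_le_mul_of_nonneg_left h3 (by linarith)
    _ = _ := by rw [he]; ring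

end Weight

/-! ### Absorption and the limit of the regularized weights -/

section Absorption

variable {n : ℕ} {Ω : Set (EuclideanSpace ℝ (Fin n))} {α δ : ℝ}
  {u : EuclideanSpace ℝ (Fin n) → ℝ} {y : EuclideanSpace ℝ (Fin n)}

/-- Uniform bounds on the integrals with the regularized weights pass to the singular weight, by
Fatou's lemma. -/
theorem integrableOn_singular_weight_of_forall_le (hΩ : IsOpen Ω) (hα : 0 ≤ α)
    {g : EuclideanSpace ℝ (Fin n) → ℝ} (hg : ContinuousOn g Ω) (hg0 : ∀ x, 0 ≤ g x) {M : ℝ}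
    (hint : ∀ ε, 0 < ε → IntegrableOn (fun x => regDistSq y ε x ^ (-α / 2) * g x) Ω)
    (hM : ∀ ε, 0 < ε → ε ≤ 1 → ∫ x in Ω, regDistSq y ε x ^ (-α / 2) * g x ≤ M) :
    IntegrableOn (fun x => ‖x - y‖ ^ (-α) * g x) Ω ∧ ∫ x in Ω, ‖x - y‖ ^ (-α) * g x ≤ M := by
  have hM0 : 0 ≤ M := by
    refine le_trans (integral_nonneg fun x => ?_) (hM 1 one_pos le_rfl)
    exact mul_nonneg (Real.rpow_nonneg (regDistSq_pos one_pos x).le _) (hg0 x)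
  set e : ℕ → ℝ := fun k => 1 / ((k : ℝ) + 1) with he
  have he0 : ∀ k, 0 < e k := fun k => by simp only [he]; positivity
  have he1 : ∀ k, e k ≤ 1 := fun k => by
    simp only [he]; rw [div_le_one (by positivity)]; linarith [(Nat.cast_nonneg k : (0 : ℝ) ≤ k)]
  have heto : Filter.Tendsto e Filter.atTop (𝓝 0) := tendsto_one_div_add_atTop_nhds_zero_nat
  have hF0 : ∀ k x, 0 ≤ regDistSq y (e k) x ^ (-α / 2) * g x := fun k x =>
    mul_nonneg (Real.rpow_nonneg (regDistSq_pos (he0 k) x).le _) (hg0 x)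
  have hnn : ∀ x, 0 ≤ ‖x - y‖ ^ (-α) * g x := fun x =>
    mul_nonneg (Real.rpow_nonneg (norm_nonneg _) _) (hg0 x)
  have hmeas : AEStronglyMeasurable (fun x => ‖x - y‖ ^ (-α) * g x) (volume.restrict Ω) := by
    refine AEStronglyMeasurable.mul ?_ (hg.aestronglyMeasurable hΩ.measurableSet)
    exact ((continuous_id.sub continuous_const).norm.measurable.pow_const
      (-α)).aestronglyMeasurable
  have hpt : ∀ x, ENNReal.ofReal (‖x - y‖ ^ (-α) * g x) ≤
      Filter.liminf (fun k => ENNReal.ofReal (regDistSq y (e k) x ^ (-α / 2) * g x))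
        Filter.atTop := by
    intro x
    by_cases hx : x = y
    · rcases hα.eq_or_lt with h0 | h0
      · subst hx
        simp [← h0]
      · subst hx
        simp [Real.zero_rpow (neg_ne_zero.2 h0.ne')]
    · have hxy : 0 < ‖x - y‖ := norm_pos_iff.2 (sub_ne_zero.2 hx)
      have hq : Filter.Tendsto (fun k => regDistSq y (e k) x) Filter.atTop (𝓝 (‖x - y‖ ^ 2)) := by
        have := (heto.pow 2).const_add (‖x - y‖ ^ 2)
        simpa [regDistSq, sum_sub_sq] using this
      have hr : (‖x - y‖ ^ 2) ^ (-α / 2) = ‖x - y‖ ^ (-α) := by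
        rw [← Real.rpow_natCast, ← Real.rpow_mul hxy.le]; congr 1; push_cast; ring
      have := ENNReal.tendsto_ofReal (((hq.rpow_const (p := -α / 2)
        (Or.inl (by positivity))).mul_const (g x)))
      rw [hr] at this
      exact this.liminf_eq.ge
  have hlin : ∫⁻ x in Ω, ENNReal.ofReal (‖x - y‖ ^ (-α) * g x) ≤ ENNReal.ofReal M := by
    calc _ ≤ ∫⁻ x in Ω, Filter.liminf
          (fun k => ENNReal.ofReal (regDistSq y (e k) x ^ (-α / 2) * g x)) Filter.atTop :=
          lintegral_mono hpt
      _ ≤ Filter.liminf (fun k => ∫⁻ x in Ω,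
          ENNReal.ofReal (regDistSq y (e k) x ^ (-α / 2) * g x)) Filter.atTop :=
          lintegral_liminf_le' fun k => (hint _ (he0 k)).aestronglyMeasurable.aemeasurable.ennreal_ofReal
      _ ≤ ENNReal.ofReal M := by
          refine Filter.liminf_le_of_le (by isBoundedDefault) fun b hb => ?_
          obtain ⟨k, hk⟩ := hb.exists
          refine hk.trans ?_
          rw [← ofReal_integral_eq_lintegral_ofReal (hint _ (he0 k))
            (Filter.Eventually.of_forall (hF0 k))]
          exact ENNReal.ofReal_le_ofReal (hM _ (he0 k) (he1 k))
  refine ⟨⟨hmeas, ?_⟩, ?_⟩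
  · rw [hasFiniteIntegral_iff_ofReal (Filter.Eventually.of_forall hnn)]
    exact hlin.trans_lt ENNReal.ofReal_lt_top
  · rw [integral_eq_lintegral_of_nonneg_ae (Filter.Eventually.of_forall hnn) hmeas]
    exact ENNReal.toReal_le_of_le_ofReal hM0 hlin

theorem measurableSet_innerSet (hΩ : IsOpen Ω) : MeasurableSet (innerSet Ω δ) :=
  hΩ.measurableSet.inter
    (isClosed_le continuous_const (Metric.continuous_infDist_pt _)).measurableSet

/-- Absorption: a bound of the weighted integral of `|∇u|²` by `κ` times the left side of the
stability inequality with `η = |x - y|_ε^{(2-α)/2} ζ` gives the weighted estimate as soon as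
`κ (α - 2)² / 4 < 1`. -/
theorem exists_weightedGradientBound_of_le (hΩ : IsOpen Ω) (hb : Bornology.IsBounded Ω)
    (hδ : 0 < δ) (hα : 0 ≤ α) {κ C₁ : ℝ} (hκ : 0 ≤ κ) (hC₁ : 0 ≤ C₁)
    (hκα : κ * ((α - 2) ^ 2 / 4) < 1) {ζ : EuclideanSpace ℝ (Fin n) → ℝ}
    (hζ : IsInnerCutoff Ω δ ζ) :
    ∃ C, 0 ≤ C ∧ ∀ u c, IsStableWithPotential Ω u c → IntegrableOn (gradSq u) Ω →
      ∀ y ∈ innerSet Ω δ,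
      (∀ ε s, 0 < ε → ε ≤ 1 → 0 < s →
        ∫ x in Ω, regDistSq y ε x ^ (-α / 2) * (ζ x ^ 2 * gradSq u x) ≤
          κ * (∫ x in Ω, (regDistSq y ε x ^ ((2 - α) / 4) * ζ x) ^ 2 * regHess u s x)
            + C₁ * ∫ x in Ω \ innerSet Ω δ, gradSq u x) →
      WeightedGradientBound Ω α δ C u y := by
  have hKm := measurableSet_innerSet hΩ (δ := δ)
  obtain ⟨d, hd⟩ := hb.exists_norm_le
  obtain ⟨B, hB⟩ := hζ.exists_sum_pd_sq_le
  -- the parameter of Young's inequality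
  obtain ⟨τ, hτ, hτκ⟩ : ∃ τ : ℝ, 0 < τ ∧ κ * ((1 + τ) * ((α - 2) ^ 2 / 4)) < 1 := by
    have h0 : 0 ≤ κ * ((α - 2) ^ 2 / 4) := by positivity
    refine ⟨(1 - κ * ((α - 2) ^ 2 / 4)) / 2, by linarith, ?_⟩
    nlinarith
  set l := κ * ((1 + τ) * ((α - 2) ^ 2 / 4)) with hl
  set Q := ((δ / 2) ^ 2) ^ ((2 - α) / 2) + ((2 * d) ^ 2 + 1) ^ ((2 - α) / 2) with hQ
  have hQ0 : 0 ≤ Q := by positivity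
  set C₂ := (1 + 1 / τ) * (Q * |B|) with hC₂
  have hC₂0 : 0 ≤ C₂ := by positivity
  set C₃ := (κ * C₂ + C₁) / (1 - l) with hC₃
  have hC₃0 : 0 ≤ C₃ := div_nonneg (by positivity) (by linarith)
  refine ⟨C₃ + (δ / 2) ^ (-α), by positivity, fun u c hst hu y hy hyp => ?_⟩
  have hG := continuousOn_gradSq hΩ hst.smooth
  set T := ∫ x in Ω \ innerSet Ω δ, gradSq u x with hT
  have hT0 : 0 ≤ T := integral_nonneg fun x => gradSq_nonneg x
  have hind : IntegrableOn ((Ω \ innerSet Ω δ).indicator (gradSq u)) Ω :=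
    hu.indicator (hΩ.measurableSet.diff hKm)
  have hindT : ∫ x in Ω, (Ω \ innerSet Ω δ).indicator (gradSq u) x = T := by
    rw [setIntegral_indicator (hΩ.measurableSet.diff hKm), inter_eq_right.2 sdiff_subset]
  have hζc : ContinuousOn ζ Ω := hζ.contDiff.continuous.continuousOn
  have hint : ∀ ε, 0 < ε → IntegrableOn
      (fun x => regDistSq y ε x ^ (-α / 2) * (ζ x ^ 2 * gradSq u x)) Ω := fun ε hε => by
    have := (contDiff_regDistSq_rpow (y := y) hε (-α / 2)).continuous.continuousOn (s := Ω)
    exact hζ.integrableOn hΩ (by fun_prop) fun x hx => by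
      simp [image_eq_zero_of_notMem_tsupport hx]
  have hbound : ∀ ε, 0 < ε → ε ≤ 1 →
      ∫ x in Ω, regDistSq y ε x ^ (-α / 2) * (ζ x ^ 2 * gradSq u x) ≤ C₃ * T := by
    intro ε hε hε1
    set I := ∫ x in Ω, regDistSq y ε x ^ (-α / 2) * (ζ x ^ 2 * gradSq u x) with hI
    have hη : IsCutoff Ω (fun x => regDistSq y ε x ^ ((2 - α) / 4) * ζ x) :=
      hζ.regDistSq_rpow_mul hΩ hε _
    set η := fun x => regDistSq y ε x ^ ((2 - α) / 4) * ζ x with hηdef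
    have hpη : ∀ i, ContinuousOn (pd i η) Ω := fun i => hη.pd.contDiff.continuous.continuousOn
    have hN : ∫ x in Ω, gradSq u x * ∑ i, pd i η x ^ 2 ≤
        (1 + τ) * ((α - 2) ^ 2 / 4) * I + C₂ * T := by
      rw [hI, ← hindT, ← integral_const_mul, ← integral_const_mul,
        ← integral_add ((hint ε hε).const_mul _) (hind.const_mul _)]
      refine setIntegral_mono_on ?_ (((hint ε hε).const_mul _).add (hind.const_mul _))
        hΩ.measurableSet fun x hx => ?_
      · exact hη.integrableOn hΩ (by fun_prop) fun x hx => by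
          simp [pd_eq_zero_of_notMem_tsupport hx]
      · have h1 := mul_le_mul_of_nonneg_left (sum_pd_weight_mul_cutoff_sq_le (y := y)
          hζ.toIsCutoff hε α hτ x) (gradSq_nonneg (u := u) x)
        refine h1.trans ?_
        rw [mul_add]
        refine add_le_add (le_of_eq (by ring)) ?_
        rcases hζ.dichotomy x hx with h | h
        · simp only [h.2]
          have : 0 ≤ (Ω \ innerSet Ω δ).indicator (gradSq u) x :=
            indicator_nonneg (fun x _ => gradSq_nonneg x) x
          simpa using mul_nonneg hC₂0 this
        · rw [indicator_of_mem h.1, mul_comm]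
          refine mul_le_mul_of_nonneg_right ?_ (gradSq_nonneg x)
          refine mul_le_mul_of_nonneg_left ?_ (by positivity)
          refine mul_le_mul ?_ ((hB x).trans (le_abs_self B)) (by positivity) hQ0
          have hq : regDistSq y ε x = ‖x - y‖ ^ 2 + ε ^ 2 := by rw [regDistSq, sum_sub_sq]
          have hxy := h.2 y hy
          have hxy2 : ‖x - y‖ ≤ 2 * d := by
            have := norm_sub_le x y
            have := hd x hx
            have := hd y hy.1
            linarith
          refine rpow_le_rpow_add_rpow (by positivity) ?_ ?_ _
          · rw [hq]; nlinarith
          · rw [hq]; nlinarith [norm_nonneg (x - y)]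
    -- letting `s → 0`
    set W := ∫ x in Ω, (∑ i, pd i η x ^ 2 - c x * η x ^ 2) with hW
    have hlim : I ≤ κ * (∫ x in Ω, gradSq u x * ∑ i, pd i η x ^ 2) + C₁ * T := by
      have hle : ∀ s : ℝ, 0 < s →
          I ≤ κ * ((∫ x in Ω, gradSq u x * ∑ i, pd i η x ^ 2) + s ^ 2 * W) + C₁ * T := by
        intro s hs
        have := hyp ε s hε hε1 hs
        have h2 := mul_le_mul_of_nonneg_left (hst.integral_regHess_le hη hs) hκ
        linarith
      have hcont : Filter.Tendsto (fun s : ℝ =>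
          κ * ((∫ x in Ω, gradSq u x * ∑ i, pd i η x ^ 2) + s ^ 2 * W) + C₁ * T) (𝓝[>] 0)
          (𝓝 (κ * (∫ x in Ω, gradSq u x * ∑ i, pd i η x ^ 2) + C₁ * T)) := by
        have : Continuous fun s : ℝ =>
          κ * ((∫ x in Ω, gradSq u x * ∑ i, pd i η x ^ 2) + s ^ 2 * W) + C₁ * T := by fun_prop
        have h := (this.tendsto 0).mono_left (nhdsWithin_le_nhds (s := Ioi 0))
        simpa using h
      exact ge_of_tendsto hcont (eventually_mem_nhdsWithin.mono fun s hs => hle s hs)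
    have h1 : I ≤ l * I + (κ * C₂ + C₁) * T := by
      have := mul_le_mul_of_nonneg_left hN hκ
      calc I ≤ _ := hlim
        _ ≤ κ * ((1 + τ) * ((α - 2) ^ 2 / 4) * I + C₂ * T) + C₁ * T := by linarith
        _ = _ := by rw [hl]; ring
    rw [hC₃, div_mul_eq_mul_div, le_div_iff₀ (by linarith)]
    linarith
  obtain ⟨hi, hle⟩ := integrableOn_singular_weight_of_forall_le hΩ hα (g := fun x => ζ x ^ 2 * gradSq u x)
    (by fun_prop) (fun x => mul_nonneg (sq_nonneg _) (gradSq_nonneg x)) hint hbound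
  have hrn : ∀ x, 0 ≤ ‖x - y‖ ^ (-α) := fun x => Real.rpow_nonneg (norm_nonneg _) _
  have hmeas : AEStronglyMeasurable (fun x => gradSq u x * ‖x - y‖ ^ (-α))
      (volume.restrict Ω) := by
    refine (hG.aestronglyMeasurable hΩ.measurableSet).mul ?_
    exact ((continuous_id.sub continuous_const).norm.measurable.pow_const
      (-α)).aestronglyMeasurable
  have hdom : ∀ x ∈ Ω, gradSq u x * ‖x - y‖ ^ (-α) ≤ ‖x - y‖ ^ (-α) * (ζ x ^ 2 * gradSq u x)
      + (δ / 2) ^ (-α) * (Ω \ innerSet Ω δ).indicator (gradSq u) x := by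
    intro x hx
    rcases hζ.dichotomy x hx with h | h
    · have h0 : 0 ≤ (Ω \ innerSet Ω δ).indicator (gradSq u) x :=
        indicator_nonneg (fun x _ => gradSq_nonneg x) x
      have := mul_nonneg (Real.rpow_nonneg (half_pos hδ).le (-α)) h0
      rw [h.1]
      linarith
    · rw [indicator_of_mem h.1]
      have h1 := Real.rpow_le_rpow_of_nonpos (half_pos hδ) (h.2 y hy) (neg_nonpos.2 hα)
      have h2 := mul_le_mul_of_nonneg_right h1 (gradSq_nonneg (u := u) x)
      have h3 := mul_nonneg (hrn x) (mul_nonneg (sq_nonneg (ζ x)) (gradSq_nonneg (u := u) x))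
      linarith
  have hsum := hi.add (hind.const_mul ((δ / 2) ^ (-α)))
  have hmain : IntegrableOn (fun x => gradSq u x * ‖x - y‖ ^ (-α)) Ω := by
    refine Integrable.mono' hsum hmeas ?_
    filter_upwards [ae_restrict_mem hΩ.measurableSet] with x hx
    rw [Real.norm_of_nonneg (mul_nonneg (gradSq_nonneg x) (hrn x))]
    exact hdom x hx
  have hgrad : ∀ x, ‖∇ u x‖ ^ 2 = gradSq u x := norm_gradient_sq u
  simp only [WeightedGradientBound, hgrad]
  refine ⟨hmain, ?_⟩
  refine (setIntegral_mono_on hmain hsum hΩ.measurableSet hdom).trans ?_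
  simp only [Pi.add_apply]
  rw [integral_add hi (hind.const_mul _), integral_const_mul, hindT, add_mul]
  linarith

end Absorption

/-! ### The Hardy inequality on level sets -/

section TangentialField

variable {n : ℕ} {Ω : Set (EuclideanSpace ℝ (Fin n))} {α δ : ℝ}
  {u : EuclideanSpace ℝ (Fin n) → ℝ} {x y : EuclideanSpace ℝ (Fin n)}

/-- The `i`-th component of `|∇u|² z_T`, where `z = x - y` and `z_T` is its tangential part with
respect to the level set of `u`; as `|∇u|² z - (z·∇u) ∇u` it is smooth at critical points too. -/
noncomputable def tangentialField (u : EuclideanSpace ℝ (Fin n) → ℝ)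
    (y : EuclideanSpace ℝ (Fin n)) (i : Fin n) (x : EuclideanSpace ℝ (Fin n)) : ℝ :=
  gradSq u x * (x i - y i) - (∑ k, (x k - y k) * pd k u x) * pd i u x

theorem contDiffOn_tangentialField (hΩ : IsOpen Ω) (hu : ContDiffOn ℝ ∞ u Ω) (i : Fin n) :
    ContDiffOn ℝ ∞ (tangentialField u y i) Ω := by
  have hp : ∀ i, ContDiffOn ℝ ∞ (pd i u) Ω := fun i => hu.pd hΩ
  have hz : ∀ i, ContDiffOn ℝ ∞ (fun x : EuclideanSpace ℝ (Fin n) => x i - y i) Ω := fun i => by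
    fun_prop
  exact ((ContDiffOn.sum fun k _ => (hp k).pow 2).mul (hz i)).sub
    ((ContDiffOn.sum fun k _ => (hz k).mul (hp k)).mul (hp i))

theorem sum_pd_tangentialField (hΩ : IsOpen Ω) (hu : ContDiffOn ℝ ∞ u Ω) (hx : x ∈ Ω) :
    ∑ i, pd i (tangentialField u y i) x = (n - 1) * gradSq u x
      + (∑ i, (x i - y i) * ∑ j, pd i (pd j u) x * pd j u x
        - (∑ i, (x i - y i) * pd i u x) * ∑ i, pd i (pd i u) x) := by
  have hp : ∀ i, DifferentiableAt ℝ (pd i u) x := fun i =>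
    (hu.pd hΩ).differentiableAt_of_isOpen hΩ hx
  have hz : ∀ i, DifferentiableAt ℝ (fun x : EuclideanSpace ℝ (Fin n) => x i - y i) x :=
    fun i => by fun_prop
  have hG : DifferentiableAt ℝ (gradSq u) x := DifferentiableAt.fun_sum fun k _ => (hp k).pow 2
  have hzp : DifferentiableAt ℝ (fun x => ∑ k, (x k - y k) * pd k u x) x :=
    DifferentiableAt.fun_sum fun k _ => (hz k).mul (hp k)
  have hpG : ∀ i, pd i (gradSq u) x = 2 * ∑ j, pd i (pd j u) x * pd j u x := fun i => by
    have hp2 : ∀ k, DifferentiableAt ℝ (fun x => pd k u x ^ 2) x := fun k => (hp k).pow 2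
    unfold gradSq
    rw [pd_sum hp2, Finset.mul_sum]
    exact Finset.sum_congr rfl fun j _ => by rw [pd_sq (hp j)]; ring
  have hpzp : ∀ i, pd i (fun x => ∑ k, (x k - y k) * pd k u x) x
      = pd i u x + ∑ k, (x k - y k) * pd k (pd i u) x := fun i => by
    have hzpk : ∀ k, DifferentiableAt ℝ (fun x => (x k - y k) * pd k u x) x :=
      fun k => (hz k).mul (hp k)
    rw [pd_sum hzpk]
    simp only [pd_mul (hz _) (hp _), pd_coord_sub, Finset.sum_add_distrib]
    congr 1
    · simp
    · exact Finset.sum_congr rfl fun k _ => by rw [pd_comm hΩ hu hx]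
  have hT : ∀ i, pd i (tangentialField u y i) x =
      2 * ((x i - y i) * ∑ j, pd i (pd j u) x * pd j u x) + gradSq u x - pd i u x ^ 2
      - ∑ k, (x k - y k) * (pd k (pd i u) x * pd i u x)
      - (∑ k, (x k - y k) * pd k u x) * pd i (pd i u) x := fun i => by
    unfold tangentialField
    have h1 : DifferentiableAt ℝ (fun x => gradSq u x * (x i - y i)) x := hG.mul (hz i)
    have h2 : DifferentiableAt ℝ (fun x => (∑ k, (x k - y k) * pd k u x) * pd i u x) x :=
      hzp.mul (hp i)
    rw [pd_sub h1 h2, pd_mul hG (hz i), pd_mul hzp (hp i), hpG, hpzp,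
      pd_coord_sub, if_pos rfl, add_mul, Finset.sum_mul]
    simp only [mul_assoc]
    ring
  simp only [hT, Finset.sum_sub_distrib, Finset.sum_add_distrib, ← Finset.mul_sum]
  rw [Finset.sum_comm]
  simp only [← Finset.mul_sum, Finset.sum_const, Finset.card_univ, Fintype.card_fin, nsmul_eq_mul]
  rw [← gradSq]
  ring

theorem sum_mul_tangentialField (a : Fin n → ℝ) : ∑ i, a i * tangentialField u y i x =
    gradSq u x * (∑ i, a i * (x i - y i))
      - (∑ i, (x i - y i) * pd i u x) * ∑ i, a i * pd i u x := by
  rw [Finset.mul_sum, Finset.mul_sum, ← Finset.sum_sub_distrib]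
  exact Finset.sum_congr rfl fun i _ => by rw [tangentialField]; ring

theorem abs_sum_mul_tangentialField_le (a : Fin n → ℝ) :
    |∑ i, a i * tangentialField u y i x| ≤
      gradSq u x * (∑ i, a i ^ 2 + ∑ i, (x i - y i) ^ 2) := by
  rw [sum_mul_tangentialField]
  have h1 := Finset.sum_mul_sq_le_sq_mul_sq Finset.univ a fun i => x i - y i
  have h2 := Finset.sum_mul_sq_le_sq_mul_sq Finset.univ (fun i => x i - y i) fun i => pd i u x
  have h3 := Finset.sum_mul_sq_le_sq_mul_sq Finset.univ a fun i => pd i u x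
  rw [← gradSq] at h2 h3
  have hG := gradSq_nonneg (u := u) x
  have hA : 0 ≤ ∑ i, a i ^ 2 := by positivity
  have hZ : 0 ≤ ∑ i, (x i - y i) ^ 2 := by positivity
  set A := ∑ i, a i ^ 2
  set Z := ∑ i, (x i - y i) ^ 2
  set b := ∑ i, a i * (x i - y i)
  set c := ∑ i, (x i - y i) * pd i u x
  set d := ∑ i, a i * pd i u x
  have hb : |b| ≤ (A + Z) / 2 := by
    apply abs_le_of_sq_le_sq _ (by positivity)
    nlinarith [sq_nonneg (A - Z)]
  have hcd : |c * d| ≤ gradSq u x * ((A + Z) / 2) := by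
    rw [abs_le]; constructor <;> nlinarith [sq_nonneg (c - d), sq_nonneg (c + d)]
  calc |gradSq u x * b - c * d| ≤ |gradSq u x * b| + |c * d| := abs_sub _ _
    _ ≤ gradSq u x * ((A + Z) / 2) + gradSq u x * ((A + Z) / 2) := by
        rw [abs_mul, abs_of_nonneg hG]
        exact add_le_add (mul_le_mul_of_nonneg_left hb hG) hcd
    _ = _ := by ring

theorem rpow_quarter_sq (α : ℝ) {q : ℝ} (hq : 0 < q) :
    (q ^ ((2 - α) / 4)) ^ 2 = q ^ (-α / 2) * q := by
  rw [← Real.rpow_natCast, ← Real.rpow_mul hq.le]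
  conv_rhs => rw [← Real.rpow_one q, ← Real.rpow_mul hq.le, one_mul, ← Real.rpow_add hq]
  congr 1; push_cast; ring

/-- Pointwise lower bound for the divergence of `|x - y|_ε^{-α} V`, where `V` is the tangential
field. -/
theorem le_div_weight_mul_tangentialField (hΩ : IsOpen Ω) (hu : ContDiffOn ℝ ∞ u Ω) (hx : x ∈ Ω)
    (hn : 2 ≤ n) (hα : 0 ≤ α) (hα₁ : α < (n : ℝ) - 1) {ε s : ℝ} (hε : 0 < ε) (hs : 0 < s) :
    (n - 1 - α) / 2 * (regDistSq y ε x ^ (-α / 2) * gradSq u x)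
      - (n - 1) / (2 * (n - 1 - α)) *
        (regDistSq y ε x ^ (-α / 2) * (regDistSq y ε x * regHess u s x))
      ≤ -α * regDistSq y ε x ^ (-α / 2 - 1) * (∑ i, (x i - y i) * tangentialField u y i x)
        + regDistSq y ε x ^ (-α / 2) * ∑ i, pd i (tangentialField u y i) x := by
  have hn1 : (0 : ℝ) ≤ n - 1 := by
    have : (2 : ℝ) ≤ n := by exact_mod_cast hn
    linarith
  rw [sum_pd_tangentialField hΩ hu hx, sum_mul_tangentialField]
  have hG0 := gradSq_nonneg (u := u) x
  have hN0 := regHess_nonneg (u := u) hs x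
  have hla := sq_sub_trace_le hn (D := fun i j => pd i (pd j u) x)
    (fun i j => pd_comm hΩ hu hx) (fun j => pd j u x) (fun i => x i - y i) s
  simp only at hla
  rw [← regHess, ← gradSq] at hla
  have hz' : ∑ i, (x i - y i) ^ 2 ≤ regDistSq y ε x := by
    rw [regDistSq]; linarith [sq_nonneg ε]
  have hzz : ∑ i, (x i - y i) * (x i - y i) = ∑ i, (x i - y i) ^ 2 := by simp only [sq]
  have hq0 : 0 < regDistSq y ε x := regDistSq_pos hε x
  rw [hzz]
  have hρ1 : regDistSq y ε x ^ (-α / 2 - 1) * regDistSq y ε x = regDistSq y ε x ^ (-α / 2) := by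
    nth_rw 2 [← Real.rpow_one (regDistSq y ε x)]
    rw [← Real.rpow_add hq0]; congr 1; ring
  have hρ0 : 0 < regDistSq y ε x ^ (-α / 2) := Real.rpow_pos_of_pos hq0 _
  have hρ' : 0 < regDistSq y ε x ^ (-α / 2 - 1) := Real.rpow_pos_of_pos hq0 _
  generalize ∑ i, (x i - y i) * ∑ j, pd i (pd j u) x * pd j u x
      - (∑ i, (x i - y i) * pd i u x) * ∑ i, pd i (pd i u) x = X at *
  generalize regDistSq y ε x ^ (-α / 2 - 1) = ρ' at *
  generalize regDistSq y ε x ^ (-α / 2) = ρ at *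
  generalize regDistSq y ε x = q at *
  generalize gradSq u x = G at *
  generalize regHess u s x = N at *
  generalize ∑ i, (x i - y i) * pd i u x = zp at *
  generalize ∑ i, (x i - y i) ^ 2 = Z at *
  obtain ⟨θ, hθ⟩ : ∃ θ, θ = (n : ℝ) - 1 - α := ⟨_, rfl⟩
  have hθ0 : 0 < θ := by rw [hθ]; linarith
  rw [← hθ]
  have hX1 : X ^ 2 ≤ (n - 1) * q * G * N := by
    refine hla.trans ?_
    refine mul_le_mul_of_nonneg_right ?_ hN0
    refine mul_le_mul_of_nonneg_right ?_ hG0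
    exact mul_le_mul_of_nonneg_left hz' hn1
  have hX2 : -(θ / 2 * G + (n - 1) / (2 * θ) * (q * N)) ≤ X := by
    have h0 : 0 ≤ θ / 2 * G + (n - 1) / (2 * θ) * (q * N) := by positivity
    refine (abs_le_of_sq_le_sq' (hX1.trans ?_) h0).1
    have e : (θ / 2 * G + (n - 1) / (2 * θ) * (q * N)) ^ 2
        = (θ / 2 * G - (n - 1) / (2 * θ) * (q * N)) ^ 2 + (n - 1) * q * G * N := by
      field_simp
      ring
    rw [e]
    linarith [sq_nonneg (θ / 2 * G - (n - 1) / (2 * θ) * (q * N))]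
  have hrad : -α * (ρ * G) ≤ -α * ρ' * (G * Z - zp * zp) := by
    have h1 : G * Z - zp * zp ≤ G * q := by
      nlinarith [mul_le_mul_of_nonneg_left hz' hG0, mul_self_nonneg zp]
    have h2 := mul_le_mul_of_nonneg_left h1 (mul_nonneg hα hρ'.le)
    have h3 : α * ρ' * (G * q) = α * (ρ * G) := by rw [← hρ1]; ring
    linarith
  have hmul := mul_le_mul_of_nonneg_left hX2 hρ0.le
  have hfin : ρ * -(θ / 2 * G + (n - 1) / (2 * θ) * (q * N)) + -α * (ρ * G)
      + ρ * ((n - 1) * G) = θ / 2 * (ρ * G) - (n - 1) / (2 * θ) * (ρ * (q * N)) := by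
    have : (n : ℝ) - 1 = θ + α := by rw [hθ]; ring
    rw [this]; ring
  rw [mul_add]
  linarith

theorem sum_pd_cutoff_mul_weight_mul_tangentialField (hΩ : IsOpen Ω) (hu : ContDiffOn ℝ ∞ u Ω)
    (hx : x ∈ Ω) {ε : ℝ} (hε : 0 < ε) {ζ : EuclideanSpace ℝ (Fin n) → ℝ}
    (hζ : DifferentiableAt ℝ ζ x) :
    ∑ i, (pd i (fun x => ζ x * ζ x) x * (regDistSq y ε x ^ (-α / 2) * tangentialField u y i x)
        + ζ x * ζ x * pd i (fun x => regDistSq y ε x ^ (-α / 2) * tangentialField u y i x) x)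
      = 2 * ζ x * regDistSq y ε x ^ (-α / 2) * (∑ i, pd i ζ x * tangentialField u y i x)
        + ζ x ^ 2 * (-α * regDistSq y ε x ^ (-α / 2 - 1) *
            (∑ i, (x i - y i) * tangentialField u y i x)
          + regDistSq y ε x ^ (-α / 2) * ∑ i, pd i (tangentialField u y i) x) := by
  have hVd := fun i =>
    (contDiffOn_tangentialField (y := y) hΩ hu i).differentiableAt_of_isOpen hΩ hx
  have hρ := (contDiff_regDistSq_rpow (y := y) hε (-α / 2)).differentiable (by simp) x
  have e : ∀ i, pd i (fun x => ζ x * ζ x) x * (regDistSq y ε x ^ (-α / 2) * tangentialField u y i x)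
      + ζ x * ζ x * pd i (fun x => regDistSq y ε x ^ (-α / 2) * tangentialField u y i x) x
      = 2 * ζ x * regDistSq y ε x ^ (-α / 2) * (pd i ζ x * tangentialField u y i x)
      + (ζ x ^ 2 * (-α * regDistSq y ε x ^ (-α / 2 - 1)) * ((x i - y i) * tangentialField u y i x)
        + ζ x ^ 2 * regDistSq y ε x ^ (-α / 2) * pd i (tangentialField u y i) x) := by
    intro i
    rw [pd_mul hζ hζ, pd_mul hρ (hVd i), pd_regDistSq_rpow hε]
    ring
  simp only [e, Finset.sum_add_distrib, ← Finset.mul_sum]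
  ring

/-- A Hardy inequality on the level sets of `u`, integrated over all level sets: the divergence
theorem for the tangential part of `(x - y) |x - y|_ε^{-α} ζ² |∇u|²`. -/
theorem exists_hardy_on_level_sets (hΩ : IsOpen Ω) (hb : Bornology.IsBounded Ω) (hn : 2 ≤ n)
    (hδ : 0 < δ) (hα : 0 ≤ α) (hα₁ : α < (n : ℝ) - 1) {ζ : EuclideanSpace ℝ (Fin n) → ℝ}
    (hζ : IsInnerCutoff Ω δ ζ) :
    ∃ C, 0 ≤ C ∧ ∀ u, ContDiffOn ℝ ∞ u Ω → IntegrableOn (gradSq u) Ω →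
      ∀ y ∈ innerSet Ω δ, ∀ ε s, 0 < ε → ε ≤ 1 → 0 < s →
        ∫ x in Ω, regDistSq y ε x ^ (-α / 2) * (ζ x ^ 2 * gradSq u x) ≤
          (n - 1) / (n - 1 - α) ^ 2 *
            (∫ x in Ω, (regDistSq y ε x ^ ((2 - α) / 4) * ζ x) ^ 2 * regHess u s x)
            + C * ∫ x in Ω \ innerSet Ω δ, gradSq u x := by
  have hKm := measurableSet_innerSet hΩ (δ := δ)
  obtain ⟨d, hd⟩ := hb.exists_norm_le
  obtain ⟨B, hB⟩ := hζ.exists_sum_pd_sq_le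
  set θ := (n : ℝ) - 1 - α with hθ
  have hθ0 : 0 < θ := by rw [hθ]; linarith
  have hn1 : (1 : ℝ) ≤ n - 1 := by
    have : (2 : ℝ) ≤ n := by exact_mod_cast hn
    linarith
  set Q := ((δ / 2) ^ 2) ^ (-α / 2) + ((2 * d) ^ 2 + 1) ^ (-α / 2) with hQ
  have hQ0 : 0 ≤ Q := by positivity
  set C₀ := 2 * (Q * (|B| + (2 * d) ^ 2)) with hC₀
  have hC₀0 : 0 ≤ C₀ := by positivity
  refine ⟨2 * C₀ / θ, by positivity, fun u hu hG1 y hy ε s hε hε1 hs => ?_⟩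
  have hG := continuousOn_gradSq hΩ hu
  have hH := continuousOn_regHess hΩ hu hs
  have hζc : ContinuousOn ζ Ω := hζ.contDiff.continuous.continuousOn
  have hρ : ∀ e : ℝ, ContDiff ℝ ∞ (fun x => regDistSq y ε x ^ e) := contDiff_regDistSq_rpow hε
  have hρc : ∀ e : ℝ, ContinuousOn (fun x => regDistSq y ε x ^ e) Ω :=
    fun e => (hρ e).continuous.continuousOn
  have hV : ∀ i, ContDiffOn ℝ ∞ (tangentialField u y i) Ω := contDiffOn_tangentialField hΩ hu
  have hF : ∀ i, ContDiffOn ℝ ∞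
      (fun x => regDistSq y ε x ^ (-α / 2) * tangentialField u y i x) Ω :=
    fun i => (hρ _).contDiffOn.mul (hV i)
  have hζ2 : IsCutoff Ω (fun x => ζ x * ζ x) := hζ.mul hΩ hζ.contDiff.contDiffOn
  have hi0 : ∀ i ∈ Finset.univ, IntegrableOn (fun x => pd i (fun x => ζ x * ζ x) x *
      (regDistSq y ε x ^ (-α / 2) * tangentialField u y i x) + ζ x * ζ x *
      pd i (fun x => regDistSq y ε x ^ (-α / 2) * tangentialField u y i x) x) Ω := fun i _ =>
    ((hζ2.pd.integrable_mul hΩ (hF i).continuousOn).add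
      (hζ2.integrable_mul hΩ ((hF i).pd hΩ).continuousOn)).integrableOn
  have key := Finset.sum_congr (rfl : (Finset.univ : Finset (Fin n)) = Finset.univ)
    fun i _ => hζ2.integral_mul_pd hΩ (hF i) i
  rw [Finset.sum_const_zero, ← integral_finsetSum _ hi0] at key
  have i1 : IntegrableOn (fun x => regDistSq y ε x ^ (-α / 2) * (ζ x ^ 2 * gradSq u x)) Ω :=
    hζ.integrableOn hΩ (by fun_prop) fun x hx => by simp [image_eq_zero_of_notMem_tsupport hx]
  have i2 : IntegrableOn
      (fun x => (regDistSq y ε x ^ ((2 - α) / 4) * ζ x) ^ 2 * regHess u s x) Ω :=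
    hζ.integrableOn hΩ (by fun_prop) fun x hx => by simp [image_eq_zero_of_notMem_tsupport hx]
  have hind : IntegrableOn ((Ω \ innerSet Ω δ).indicator (gradSq u)) Ω :=
    hG1.indicator (hΩ.measurableSet.diff hKm)
  have hindT : ∫ x in Ω, (Ω \ innerSet Ω δ).indicator (gradSq u) x
      = ∫ x in Ω \ innerSet Ω δ, gradSq u x := by
    rw [setIntegral_indicator (hΩ.measurableSet.diff hKm), inter_eq_right.2 sdiff_subset]
  have hpt : ∀ x ∈ Ω,
      θ / 2 * (regDistSq y ε x ^ (-α / 2) * (ζ x ^ 2 * gradSq u x))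
      - (n - 1) / (2 * θ) * ((regDistSq y ε x ^ ((2 - α) / 4) * ζ x) ^ 2 * regHess u s x)
      - C₀ * (Ω \ innerSet Ω δ).indicator (gradSq u) x
      ≤ ∑ i, (pd i (fun x => ζ x * ζ x) x *
      (regDistSq y ε x ^ (-α / 2) * tangentialField u y i x) + ζ x * ζ x *
      pd i (fun x => regDistSq y ε x ^ (-α / 2) * tangentialField u y i x) x) := by
    intro x hx
    have hζd : DifferentiableAt ℝ ζ x := hζ.contDiff.differentiable (by simp) x
    rw [sum_pd_cutoff_mul_weight_mul_tangentialField hΩ hu hx hε hζd]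
    have hmain := mul_le_mul_of_nonneg_left (le_div_weight_mul_tangentialField (y := y) hΩ hu hx hn
      hα hα₁ hε hs) (sq_nonneg (ζ x))
    have hq0 : 0 < regDistSq y ε x := regDistSq_pos hε x
    have hρ0 : 0 < regDistSq y ε x ^ (-α / 2) := Real.rpow_pos_of_pos hq0 _
    have hρ2 := rpow_quarter_sq α hq0
    have hG0 := gradSq_nonneg (u := u) x
    have herr : -(C₀ * (Ω \ innerSet Ω δ).indicator (gradSq u) x) ≤
        2 * ζ x * regDistSq y ε x ^ (-α / 2) * (∑ i, pd i ζ x * tangentialField u y i x) := by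
      rcases hζ.dichotomy x hx with h | h
      · have : 0 ≤ (Ω \ innerSet Ω δ).indicator (gradSq u) x :=
          indicator_nonneg (fun x _ => gradSq_nonneg x) x
        simp only [h.2, zero_mul, Finset.sum_const_zero, mul_zero]
        linarith [mul_nonneg hC₀0 this]
      · rw [indicator_of_mem h.1]
        refine (neg_le_neg ?_).trans (neg_abs_le _)
        have hqe : regDistSq y ε x = ‖x - y‖ ^ 2 + ε ^ 2 := by rw [regDistSq, sum_sub_sq]
        have hxy := h.2 y hy
        have hxy2 : ‖x - y‖ ≤ 2 * d := by
          have := norm_sub_le x y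
          have := hd x hx
          have := hd y hy.1
          linarith
        have hρQ : regDistSq y ε x ^ (-α / 2) ≤ Q := by
          refine rpow_le_rpow_add_rpow (by positivity) ?_ ?_ _
          · rw [hqe]; nlinarith
          · rw [hqe]; nlinarith [norm_nonneg (x - y)]
        have hW := abs_sum_mul_tangentialField_le (u := u) (y := y) (x := x) fun i => pd i ζ x
        have hW2 : |∑ i, pd i ζ x * tangentialField u y i x| ≤ gradSq u x * (|B| + (2 * d) ^ 2) := by
          refine hW.trans (mul_le_mul_of_nonneg_left (add_le_add ((hB x).trans (le_abs_self B)) ?_)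
            hG0)
          rw [sum_sub_sq]
          exact pow_le_pow_left₀ (norm_nonneg _) hxy2 2
        have hζ1 : |ζ x| ≤ 1 := (sq_le_one_iff_abs_le_one _).1 (hζ.sq_le_one x)
        rw [abs_mul, abs_mul, abs_mul, abs_two, abs_of_pos hρ0]
        calc 2 * |ζ x| * regDistSq y ε x ^ (-α / 2) * |∑ i, pd i ζ x * tangentialField u y i x|
            ≤ 2 * 1 * Q * (gradSq u x * (|B| + (2 * d) ^ 2)) := by gcongr
          _ = _ := by rw [hC₀]; ring
    rw [mul_pow, hρ2]
    rw [← hθ] at hmain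
    linarith
  have h1 := setIntegral_mono_on (((i1.const_mul (θ / 2)).sub (i2.const_mul ((n - 1) / (2 * θ)))).sub
    (hind.const_mul C₀)) (integrable_finsetSum _ hi0) hΩ.measurableSet hpt
  have i12 := (i1.const_mul (θ / 2)).sub (i2.const_mul ((n - 1) / (2 * θ)))
  simp only [Pi.sub_def] at i12
  rw [key] at h1
  simp only [Pi.sub_apply] at h1
  rw [integral_sub i12 (hind.const_mul C₀),
    integral_sub (i1.const_mul (θ / 2)) (i2.const_mul ((n - 1) / (2 * θ))),
    integral_const_mul, integral_const_mul, integral_const_mul, hindT] at h1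
  set I := ∫ x in Ω, regDistSq y ε x ^ (-α / 2) * (ζ x ^ 2 * gradSq u x)
  set S := ∫ x in Ω, (regDistSq y ε x ^ ((2 - α) / 4) * ζ x) ^ 2 * regHess u s x
  set T := ∫ x in Ω \ innerSet Ω δ, gradSq u x
  have h2 : θ / 2 * I ≤ (n - 1) / (2 * θ) * S + C₀ * T := by linarith
  calc I = 2 / θ * (θ / 2 * I) := by field_simp
    _ ≤ 2 / θ * ((n - 1) / (2 * θ) * S + C₀ * T) := mul_le_mul_of_nonneg_left h2 (by positivity)
    _ = _ := by field_simp

end TangentialField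

/-! ### The estimate in general domains -/

section BoundedGradient

variable {n : ℕ} {Ω : Set (EuclideanSpace ℝ (Fin n))} {u : EuclideanSpace ℝ (Fin n) → ℝ}

/-- A function that is `C¹` up to the boundary has bounded gradient. No regularity of the boundary
is used, only the definition of `ContDiffOn` on the closure. -/
theorem exists_norm_fderiv_le (hΩ : IsOpen Ω) (hb : Bornology.IsBounded Ω)
    (hu : ContDiffOn ℝ ∞ u (closure Ω)) : ∃ M, ∀ x ∈ Ω, ‖fderiv ℝ u x‖ ≤ M := by
  have hK : IsCompact (closure Ω) := hb.isCompact_closure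
  suffices h : ∃ M, ∀ x ∈ closure Ω ∩ Ω, ‖fderiv ℝ u x‖ ≤ M by
    obtain ⟨M, hM⟩ := h
    exact ⟨M, fun x hx => hM x ⟨subset_closure hx, hx⟩⟩
  refine hK.induction_on (p := fun S => ∃ M, ∀ x ∈ S ∩ Ω, ‖fderiv ℝ u x‖ ≤ M)
    ⟨0, by simp⟩ ?_ ?_ ?_
  · rintro s t hst ⟨M, hM⟩
    exact ⟨M, fun x hx => hM x ⟨hst hx.1, hx.2⟩⟩
  · rintro s t ⟨M, hM⟩ ⟨M', hM'⟩
    refine ⟨max M M', fun x hx => ?_⟩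
    rcases hx.1 with h | h
    · exact (hM x ⟨h, hx.2⟩).trans (le_max_left _ _)
    · exact (hM' x ⟨h, hx.2⟩).trans (le_max_right _ _)
  · intro x hx
    have h1 : ContDiffWithinAt ℝ (0 + 1) u (closure Ω) x := (hu x hx).of_le (by simp)
    obtain ⟨v, hv, -, f', hf', hf'c⟩ :=
      (contDiffWithinAt_succ_iff_hasFDerivWithinAt (by simp)).1 h1
    rw [insert_eq_of_mem hx] at hv
    have hc : ContinuousWithinAt f' v x := hf'c.continuousWithinAt
    have hxv : x ∈ v := mem_of_mem_nhdsWithin hx hv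
    have hev : ∀ᶠ z in 𝓝[v] x, ‖f' z‖ < ‖f' x‖ + 1 :=
      hc.norm.eventually_lt continuousWithinAt_const (by simp)
    obtain ⟨O, hO, hxO, hOv⟩ := mem_nhdsWithin.1 hv
    obtain ⟨O', hO', hxO', hOv'⟩ := eventually_nhdsWithin_iff.1 hev |> eventually_nhds_iff.1 |>
      fun ⟨t, ht, hto, hxt⟩ => (⟨t, hto, hxt, ht⟩ : ∃ t, IsOpen t ∧ x ∈ t ∧ ∀ z ∈ t, z ∈ v →
        ‖f' z‖ < ‖f' x‖ + 1)
    refine ⟨O ∩ O', mem_nhdsWithin_of_mem_nhds ((hO.inter hO').mem_nhds ⟨hxO, hxO'⟩),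
      ‖f' x‖ + 1, fun z hz => ?_⟩
    have hzv : v ∈ 𝓝 z := Filter.mem_of_superset ((hO.inter hΩ).mem_nhds ⟨hz.1.1, hz.2⟩)
      fun w hw => hOv ⟨hw.1, subset_closure hw.2⟩
    have hzm : z ∈ v := mem_of_mem_nhds hzv
    rw [((hf' z hzm).hasFDerivAt hzv).fderiv]
    exact (hOv' z hz.1.2 hzm).le

theorem abs_pd_le (i : Fin n) (x : EuclideanSpace ℝ (Fin n)) : |pd i u x| ≤ ‖fderiv ℝ u x‖ := by
  have := (fderiv ℝ u x).le_opNorm (EuclideanSpace.single i 1)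
  simpa [pd] using this

theorem integrableOn_gradSq (hΩ : IsOpen Ω) (hb : Bornology.IsBounded Ω)
    (hu : ContDiffOn ℝ ∞ u (closure Ω)) : IntegrableOn (gradSq u) Ω := by
  obtain ⟨M, hM⟩ := exists_norm_fderiv_le hΩ hb hu
  refine IntegrableOn.of_bound hb.measure_lt_top
    ((continuousOn_gradSq hΩ (hu.mono subset_closure)).aestronglyMeasurable hΩ.measurableSet)
    (∑ _i : Fin n, M ^ 2) ?_
  filter_upwards [ae_restrict_mem hΩ.measurableSet] with x hx
  rw [Real.norm_of_nonneg (gradSq_nonneg x)]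
  refine Finset.sum_le_sum fun i _ => ?_
  rw [← sq_abs]
  exact pow_le_pow_left₀ (abs_nonneg _) ((abs_pd_le i x).trans (hM x hx)) 2

end BoundedGradient

section InteriorEstimate

variable {n : ℕ} {Ω : Set (EuclideanSpace ℝ (Fin n))} {α δ : ℝ}

/-- The estimate without boundary condition. It holds in any bounded open set. -/
theorem exists_weightedGradientBound (hΩ : IsOpen Ω) (hb : Bornology.IsBounded Ω)
    (hα₀ : 0 ≤ α) (hα₁ : α < (n : ℝ) - 1)
    (hα : (α - 2) ^ 2 / 4 < ((n : ℝ) - 1 - α) ^ 2 / ((n : ℝ) - 1)) (hδ : 0 < δ) :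
    ∃ C : ℝ, ∀ (f : ℝ → ℝ) (u : EuclideanSpace ℝ (Fin n) → ℝ),
      ContDiff ℝ 1 f → IsSmoothSolution Ω f u → IsStable Ω f u →
      ∀ y ∈ innerSet Ω δ, WeightedGradientBound Ω α δ C u y := by
  have hn1 : (0 : ℝ) < n - 1 := hα₀.trans_lt hα₁
  have hn : 2 ≤ n := by
    have : (1 : ℝ) < n := by linarith
    exact_mod_cast this
  have hθ : (0 : ℝ) < (n - 1 - α) ^ 2 := by
    have : (0 : ℝ) < n - 1 - α := by linarith
    positivity
  obtain ⟨ζ, hζ⟩ := exists_isInnerCutoff hΩ hb hδ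
  obtain ⟨C₁, hC₁, h₁⟩ := exists_hardy_on_level_sets hΩ hb hn hδ hα₀ hα₁ hζ
  have hκα : (n - 1 : ℝ) / (n - 1 - α) ^ 2 * ((α - 2) ^ 2 / 4) < 1 := by
    rw [div_mul_eq_mul_div, div_lt_one hθ, mul_comm]
    exact (lt_div_iff₀ hn1).1 hα
  obtain ⟨C, -, h⟩ := exists_weightedGradientBound_of_le hΩ hb hδ hα₀
    (div_nonneg hn1.le hθ.le) hC₁ hκα hζ
  refine ⟨C, fun f u hf hu hs y hy => ?_⟩
  have hst := isStableWithPotential_of_isStable hΩ hf hu hs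
  have hint := integrableOn_gradSq hΩ hb hu.smooth
  exact h u _ hst hint y hy fun ε s hε hε1 hs => h₁ u hst.smooth hint y hy ε s hε hε1 hs

end InteriorEstimate

/-! ### Rotations and angular derivatives -/

section Rotation

variable {n : ℕ} {Ω : Set (EuclideanSpace ℝ (Fin n))} {i j : Fin n}
  {u c : EuclideanSpace ℝ (Fin n) → ℝ} {x : EuclideanSpace ℝ (Fin n)} {R : ℝ}

/-- The velocity at `x` of the rotation in the plane of the coordinates `i` and `j`. -/
noncomputable def rotVec (i j : Fin n) (x : EuclideanSpace ℝ (Fin n)) :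
    EuclideanSpace ℝ (Fin n) :=
  x i • EuclideanSpace.single j 1 - x j • EuclideanSpace.single i 1

/-- The rotation by the angle `θ` in the plane of the coordinates `i` and `j`. It is a rotation only
when `i ≠ j`. -/
noncomputable def rot (i j : Fin n) (θ : ℝ) :
    EuclideanSpace ℝ (Fin n) →ₗ[ℝ] EuclideanSpace ℝ (Fin n) where
  toFun x := x + ((Real.cos θ - 1) * x i - Real.sin θ * x j) • EuclideanSpace.single i 1
    + ((Real.cos θ - 1) * x j + Real.sin θ * x i) • EuclideanSpace.single j 1
  map_add' x y := by
    simp only [PiLp.add_apply]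
    module
  map_smul' a x := by
    simp only [PiLp.smul_apply, smul_eq_mul, RingHom.id_apply]
    module

theorem rot_apply (θ : ℝ) (x : EuclideanSpace ℝ (Fin n)) : rot i j θ x =
    x + ((Real.cos θ - 1) * x i - Real.sin θ * x j) • EuclideanSpace.single i 1
      + ((Real.cos θ - 1) * x j + Real.sin θ * x i) • EuclideanSpace.single j 1 := rfl

theorem norm_rot (hij : i ≠ j) (θ : ℝ) (x : EuclideanSpace ℝ (Fin n)) : ‖rot i j θ x‖ = ‖x‖ := by
  rw [← sq_eq_sq₀ (norm_nonneg _) (norm_nonneg _), rot_apply]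
  simp only [← real_inner_self_eq_norm_sq, inner_add_left, inner_add_right, inner_smul_left,
    inner_smul_right, EuclideanSpace.inner_single_left, EuclideanSpace.inner_single_right]
  simp [hij, hij.symm]
  linear_combination (x i ^ 2 + x j ^ 2) * Real.sin_sq_add_cos_sq θ

theorem hasDerivAt_rot (hij : i ≠ j) (x : EuclideanSpace ℝ (Fin n)) (θ : ℝ) :
    HasDerivAt (fun t => rot i j t x) (rotVec i j (rot i j θ x)) θ := by
  have h1 : HasDerivAt (fun t => (Real.cos t - 1) * x i - Real.sin t * x j)
      (-Real.sin θ * x i - Real.cos θ * x j) θ :=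
    (((Real.hasDerivAt_cos θ).sub_const 1).mul_const _).sub ((Real.hasDerivAt_sin θ).mul_const _)
  have h2 : HasDerivAt (fun t => (Real.cos t - 1) * x j + Real.sin t * x i)
      (-Real.sin θ * x j + Real.cos θ * x i) θ :=
    (((Real.hasDerivAt_cos θ).sub_const 1).mul_const _).add ((Real.hasDerivAt_sin θ).mul_const _)
  have h := ((hasDerivAt_const θ x).add
    (h1.smul_const (EuclideanSpace.single i (1 : ℝ)))).add
    (h2.smul_const (EuclideanSpace.single j (1 : ℝ)))
  refine h.congr_deriv ?_
  have e1 : (rot i j θ x) i = Real.cos θ * x i - Real.sin θ * x j := by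
    rw [rot_apply]; simp [hij]; ring
  have e2 : (rot i j θ x) j = Real.cos θ * x j + Real.sin θ * x i := by
    rw [rot_apply]; simp [hij.symm]; ring
  rw [rotVec, e1, e2]
  module

theorem rot_zero : rot i j 0 x = x := by simp [rot_apply]

theorem rot_two_pi : rot i j (2 * Real.pi) x = x := by simp [rot_apply]

/-- The rotation as a linear isometry. -/
noncomputable def rotEquiv (hij : i ≠ j) (θ : ℝ) :
    EuclideanSpace ℝ (Fin n) ≃ₗᵢ[ℝ] EuclideanSpace ℝ (Fin n) :=
  LinearIsometry.toLinearIsometryEquiv ⟨rot i j θ, norm_rot hij θ⟩ rfl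

/-- The angular derivative `x_i ∂_j u - x_j ∂_i u`. -/
noncomputable def angDeriv (i j : Fin n) (u : EuclideanSpace ℝ (Fin n) → ℝ)
    (x : EuclideanSpace ℝ (Fin n)) : ℝ :=
  x i * pd j u x - x j * pd i u x

theorem fderiv_rotVec : fderiv ℝ u x (rotVec i j x) = angDeriv i j u x := by
  simp [rotVec, angDeriv, pd]

theorem contDiffOn_angDeriv (hΩ : IsOpen Ω) (hu : ContDiffOn ℝ ∞ u Ω) :
    ContDiffOn ℝ ∞ (angDeriv i j u) Ω := by
  have h : ∀ k, ContDiffOn ℝ ∞ (fun x : EuclideanSpace ℝ (Fin n) => x k) Ω := fun k => by fun_prop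
  exact ((h i).mul (hu.pd hΩ)).sub ((h j).mul (hu.pd hΩ))

/-- Since the Laplacian commutes with rotations, the angular derivatives are Jacobi fields too. -/
theorem IsStableWithPotential.jacobi_angDeriv (h : IsStableWithPotential Ω u c) (hx : x ∈ Ω) :
    ∑ k, pd k (pd k (angDeriv i j u)) x = -(c x * angDeriv i j u x) := by
  have hΩ := h.isOpen
  have hp : ∀ k, ContDiffOn ℝ ∞ (pd k u) Ω := fun k => h.smooth.pd hΩ
  have hco : ∀ (k : Fin n) x, DifferentiableAt ℝ (fun x : EuclideanSpace ℝ (Fin n) => x k) x :=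
    fun k x => by fun_prop
  have hmul : ∀ (a k : Fin n) {F : EuclideanSpace ℝ (Fin n) → ℝ}, ContDiffOn ℝ ∞ F Ω →
      ∀ y ∈ Ω, pd k (fun x => x a * F x) y = (if k = a then F y else 0) + y a * pd k F y := by
    intro a k F hF y hy
    rw [pd_mul (hco a y) (hF.differentiableAt_of_isOpen hΩ hy), pd_coord]
    simp
  have hd : ∀ (a : Fin n) {F : EuclideanSpace ℝ (Fin n) → ℝ}, ContDiffOn ℝ ∞ F Ω →
      ∀ y ∈ Ω, DifferentiableAt ℝ (fun x => x a * F x) y := fun a F hF y hy =>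
    (hco a y).mul (hF.differentiableAt_of_isOpen hΩ hy)
  have h1 : ∀ k, pd k (angDeriv i j u) =ᶠ[𝓝 x] fun y =>
      ((if k = i then 1 else 0) * pd j u y + y i * pd k (pd j u) y)
        - ((if k = j then 1 else 0) * pd i u y + y j * pd k (pd i u) y) := by
    intro k
    filter_upwards [hΩ.mem_nhds hx] with y hy
    have := pd_sub (i := k) (hd i (hp j) y hy) (hd j (hp i) y hy)
    unfold angDeriv
    rw [this, hmul i k (hp j) y hy, hmul j k (hp i) y hy]
    simp
  have h2 : ∀ k, pd k (pd k (angDeriv i j u)) x =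
      (2 * (if k = i then pd k (pd j u) x else 0) + x i * pd k (pd k (pd j u)) x)
        - (2 * (if k = j then pd k (pd i u) x else 0) + x j * pd k (pd k (pd i u)) x) := by
    intro k
    have hc : ∀ (a : ℝ) (m : Fin n), DifferentiableAt ℝ (fun y => a * pd m u y) x := fun a m =>
      ((hp m).differentiableAt_of_isOpen hΩ hx).const_mul a
    have hcc : ∀ (a : ℝ) (m : Fin n), pd k (fun y => a * pd m u y) x = a * pd k (pd m u) x :=
      fun a m => by
        rw [pd_mul (differentiableAt_const a) ((hp m).differentiableAt_of_isOpen hΩ hx), pd_const]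
        ring
    have hpp : ∀ m, ContDiffOn ℝ ∞ (pd k (pd m u)) Ω := fun m => (hp m).pd hΩ
    rw [pd_congr (h1 k), pd_sub ((hc _ j).fun_add (hd i (hpp j) x hx))
      ((hc _ i).fun_add (hd j (hpp i) x hx)), pd_add (hc _ j) (hd i (hpp j) x hx),
      pd_add (hc _ i) (hd j (hpp i) x hx), hcc, hcc, hmul i k (hpp j) x hx, hmul j k (hpp i) x hx]
    split_ifs <;> ring
  simp only [h2, Finset.sum_sub_distrib, Finset.sum_add_distrib, ← Finset.mul_sum, h.jacobi _ x hx]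
  simp only [Finset.sum_ite_eq', Finset.mem_univ, if_true, angDeriv]
  rw [pd_comm hΩ h.smooth hx (i := i) (j := j)]
  ring

/-- If `u` is smooth up to the boundary of a ball and vanishes on it, then so does its angular
derivative, which is therefore bounded by a multiple of the distance to the boundary. -/
theorem exists_abs_angDeriv_le (hR : 0 < R)
    (hu : ContDiffOn ℝ ∞ u (closure (Metric.ball (0 : EuclideanSpace ℝ (Fin n)) R)))
    (hu0 : ∀ x ∈ frontier (Metric.ball (0 : EuclideanSpace ℝ (Fin n)) R), u x = 0) (hij : i ≠ j) :
    ∃ L, 0 ≤ L ∧ ∀ x ∈ Metric.ball (0 : EuclideanSpace ℝ (Fin n)) R,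
      |angDeriv i j u x| ≤ L * (R - ‖x‖) := by
  rw [closure_ball _ hR.ne'] at hu
  rw [frontier_ball _ hR.ne'] at hu0
  set K := Metric.closedBall (0 : EuclideanSpace ℝ (Fin n)) R with hK
  have hconv : Convex ℝ K := convex_closedBall _ _
  have hun : UniqueDiffOn ℝ K := uniqueDiffOn_convex hconv
    ⟨0, Metric.ball_subset_interior_closedBall (Metric.mem_ball_self hR)⟩
  have hcomp : IsCompact K := isCompact_closedBall _ _
  set w := fun x => fderivWithin ℝ u K x (rotVec i j x) with hw
  have hrv : ContDiffOn ℝ ∞ (rotVec i j) K := by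
    unfold rotVec; fun_prop
  have hwc : ContDiffOn ℝ ∞ w K := (hu.fderivWithin hun (by simp)).clm_apply hrv
  have hwd : DifferentiableOn ℝ w K := hwc.differentiableOn (by simp)
  obtain ⟨L, hL⟩ := hcomp.exists_bound_of_continuousOn
    (hwc.continuousOn_fderivWithin hun (by simp))
  have hw0 : ∀ z, ‖z‖ = R → w z = 0 := by
    intro z hz
    have hmem : ∀ t, rot i j t z ∈ K := fun t => by
      rw [hK, mem_closedBall_zero_iff, norm_rot hij, hz]
    have hzK : z ∈ K := by rw [hK, mem_closedBall_zero_iff, hz]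
    have h1 : HasFDerivWithinAt u (fderivWithin ℝ u K z) K (rot i j 0 z) := by
      rw [rot_zero]
      exact (hu.differentiableOn (by simp) z hzK).hasFDerivWithinAt
    have h2 := h1.comp_hasDerivAt 0 (hasDerivAt_rot hij z 0) (Filter.Eventually.of_forall hmem)
    have h3 : u ∘ (fun t => rot i j t z) = fun _ => 0 := by
      funext t
      exact hu0 _ (by rw [mem_sphere_zero_iff_norm, norm_rot hij, hz])
    rw [h3, rot_zero] at h2
    exact h2.unique (hasDerivAt_const 0 0)
  refine ⟨|L|, abs_nonneg _, fun x hx => ?_⟩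
  have hxK : x ∈ K := Metric.ball_subset_closedBall hx
  have hxR : ‖x‖ < R := mem_ball_zero_iff.1 hx
  -- a nearest point of the sphere
  obtain ⟨z, hz, hzx⟩ : ∃ z : EuclideanSpace ℝ (Fin n), ‖z‖ = R ∧ ‖x - z‖ = R - ‖x‖ := by
    rcases eq_or_ne x 0 with h0 | h0
    · refine ⟨EuclideanSpace.single i R, ?_, ?_⟩ <;> simp [h0, abs_of_pos hR]
    · have hxp : 0 < ‖x‖ := norm_pos_iff.2 h0
      refine ⟨(R / ‖x‖) • x, ?_, ?_⟩
      · rw [norm_smul, Real.norm_of_nonneg (by positivity)]; field_simp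
      · have : x - (R / ‖x‖) • x = (1 - R / ‖x‖) • x := by module
        rw [this, norm_smul, Real.norm_of_nonpos]
        · field_simp
          ring
        · rw [sub_nonpos, le_div_iff₀ hxp]; linarith
  have hzK : z ∈ K := by rw [hK, mem_closedBall_zero_iff, hz]
  have h := hconv.norm_image_sub_le_of_norm_fderivWithin_le hwd hL hzK hxK
  rw [hw0 z hz, sub_zero, hzx] at h
  have hwx : w x = angDeriv i j u x := by
    rw [← fderiv_rotVec, hw]
    simp only
    rw [fderivWithin_of_mem_nhds]
    exact Filter.mem_of_superset (Metric.isOpen_ball.mem_nhds hx) Metric.ball_subset_closedBall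
  rw [hwx] at h
  exact h.trans (mul_le_mul_of_nonneg_right (le_abs_self L) (by linarith))

end Rotation

/-! ### Radial cutoffs of a ball -/

section RadialCutoff

variable {n : ℕ} {R τ : ℝ} {x : EuclideanSpace ℝ (Fin n)}

/-- A radial cutoff of the ball of radius `R`: it vanishes for `R² - |x|² ≤ τ` and equals `1` for
`R² - |x|² ≥ 2τ`. -/
noncomputable def radialCutoff (R τ : ℝ) (x : EuclideanSpace ℝ (Fin n)) : ℝ :=
  Real.smoothTransition ((R ^ 2 - ‖x‖ ^ 2) / τ - 1)

theorem radialCutoff_eq_zero (hτ : 0 < τ) (hx : R ^ 2 - ‖x‖ ^ 2 ≤ τ) : radialCutoff R τ x = 0 := by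
  refine Real.smoothTransition.zero_of_nonpos ?_
  rw [sub_nonpos, div_le_one hτ]; exact hx

theorem radialCutoff_eq_one (hτ : 0 < τ) (hx : 2 * τ ≤ R ^ 2 - ‖x‖ ^ 2) :
    radialCutoff R τ x = 1 := by
  refine Real.smoothTransition.one_of_one_le ?_
  rw [le_sub_iff_add_le, le_div_iff₀ hτ]; linarith

theorem pd_radialCutoff_eq_zero (i : Fin n) (hτ : 0 < τ) (hx : 2 * τ < R ^ 2 - ‖x‖ ^ 2) :
    pd i (radialCutoff R τ) x = 0 := by
  have hev : radialCutoff R τ =ᶠ[𝓝 x] fun _ => 1 := by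
    have : IsOpen {z : EuclideanSpace ℝ (Fin n) | 2 * τ < R ^ 2 - ‖z‖ ^ 2} :=
      isOpen_lt continuous_const (by fun_prop)
    filter_upwards [this.mem_nhds hx] with z hz using radialCutoff_eq_one hτ (le_of_lt hz)
  rw [pd_congr hev, pd_const]

theorem radialCutoff_nonneg (x : EuclideanSpace ℝ (Fin n)) : 0 ≤ radialCutoff R τ x :=
  Real.smoothTransition.nonneg _

theorem radialCutoff_sq_le_one (x : EuclideanSpace ℝ (Fin n)) : radialCutoff R τ x ^ 2 ≤ 1 :=
  pow_le_one₀ (radialCutoff_nonneg x) (Real.smoothTransition.le_one _)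

theorem isCutoff_radialCutoff (hR : 0 < R) (hτ : 0 < τ) :
    IsCutoff (Metric.ball (0 : EuclideanSpace ℝ (Fin n)) R) (radialCutoff R τ) := by
  have hsub : tsupport (radialCutoff (n := n) R τ) ⊆ {x | τ ≤ R ^ 2 - ‖x‖ ^ 2} := by
    refine closure_minimal (fun x hx => ?_) (isClosed_le continuous_const (by fun_prop))
    by_contra h
    exact hx (radialCutoff_eq_zero hτ (not_le.1 h).le)
  have hball : tsupport (radialCutoff (n := n) R τ) ⊆ Metric.ball 0 R := by
    refine hsub.trans fun x hx => ?_
    rw [mem_ball_zero_iff]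
    have : τ ≤ R ^ 2 - ‖x‖ ^ 2 := hx
    exact lt_of_pow_lt_pow_left₀ 2 hR.le (by linarith)
  refine ⟨?_, ?_, hball⟩
  · exact Real.smoothTransition.contDiff.comp
      (((contDiff_const.sub (contDiff_norm_sq ℝ)).div_const τ).sub contDiff_const)
  · exact (isCompact_closedBall (0 : EuclideanSpace ℝ (Fin n)) R).of_isClosed_subset
      (isClosed_tsupport _) (hball.trans Metric.ball_subset_closedBall)

theorem exists_abs_deriv_smoothTransition_le :
    ∃ D, ∀ t, |deriv Real.smoothTransition t| ≤ D := by
  have hc : Continuous (deriv Real.smoothTransition) :=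
    (Real.smoothTransition.contDiff (n := 1)).continuous_deriv le_rfl
  obtain ⟨D, hD⟩ := (isCompact_Icc (a := (0 : ℝ)) (b := 1)).exists_bound_of_continuousOn
    hc.continuousOn
  refine ⟨D, fun t => ?_⟩
  have hD0 : 0 ≤ D := (norm_nonneg _).trans (hD 0 (by simp))
  rcases lt_or_ge t 0 with h0 | h0
  · have : Real.smoothTransition =ᶠ[𝓝 t] fun _ => 0 := by
      filter_upwards [Iio_mem_nhds h0] with r hr using
        Real.smoothTransition.zero_of_nonpos (le_of_lt hr)
    rw [this.deriv_eq]
    simpa using hD0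
  rcases lt_or_ge 1 t with h1 | h1
  · have : Real.smoothTransition =ᶠ[𝓝 t] fun _ => 1 := by
      filter_upwards [Ioi_mem_nhds h1] with r hr using
        Real.smoothTransition.one_of_one_le (le_of_lt hr)
    rw [this.deriv_eq]
    simpa using hD0
  · exact hD t ⟨h0, h1⟩

theorem pd_norm_sq (i : Fin n) (x : EuclideanSpace ℝ (Fin n)) :
    pd i (fun x : EuclideanSpace ℝ (Fin n) => ‖x‖ ^ 2) x = 2 * x i := by
  have h : (fun x : EuclideanSpace ℝ (Fin n) => ‖x‖ ^ 2) = regDistSq 0 0 := by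
    funext x
    rw [regDistSq, sum_sub_sq]; simp
  rw [h, pd_regDistSq]; simp

theorem pd_radialCutoff (i : Fin n) (x : EuclideanSpace ℝ (Fin n)) :
    pd i (radialCutoff R τ) x =
      deriv Real.smoothTransition ((R ^ 2 - ‖x‖ ^ 2) / τ - 1) * (-(2 * x i) / τ) := by
  have hn : DifferentiableAt ℝ (fun x : EuclideanSpace ℝ (Fin n) => ‖x‖ ^ 2) x :=
    (contDiff_norm_sq ℝ (n := 1)).differentiable (by simp) x
  have h2 : DifferentiableAt ℝ (fun x : EuclideanSpace ℝ (Fin n) =>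
      (R ^ 2 - ‖x‖ ^ 2) / τ - 1) x := by
    simp only [div_eq_mul_inv]
    exact ((hn.const_sub _).mul_const _).sub_const _
  have h := pd_comp (i := i) (F := fun x => (R ^ 2 - ‖x‖ ^ 2) / τ - 1) (x := x)
    (((Real.smoothTransition.contDiff (n := 1)).differentiable (by simp) _).hasDerivAt) h2
  unfold radialCutoff
  rw [h]
  congr 1
  have hφ : HasDerivAt (fun t : ℝ => (R ^ 2 - t) / τ - 1) (-1 / τ) (‖x‖ ^ 2) := by
    simpa using (((hasDerivAt_id (‖x‖ ^ 2)).const_sub (R ^ 2)).div_const τ).sub_const 1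
  rw [pd_comp (F := fun x : EuclideanSpace ℝ (Fin n) => ‖x‖ ^ 2) hφ hn, pd_norm_sq]
  ring

/-- A function bounded by a multiple of the distance to the boundary can be cut off near the
boundary at an arbitrarily small cost in Dirichlet energy. -/
theorem exists_radialCutoff_integral_le (hR : 0 < R) {w : EuclideanSpace ℝ (Fin n) → ℝ} {L : ℝ}
    (hL : 0 ≤ L) (hw : ContinuousOn w (Metric.ball 0 R))
    (hwL : ∀ x ∈ Metric.ball (0 : EuclideanSpace ℝ (Fin n)) R, |w x| ≤ L * (R - ‖x‖))
    {κ τ₀ : ℝ} (hκ : 0 < κ) (hτ₀ : 0 < τ₀) : ∃ τ, 0 < τ ∧ τ ≤ τ₀ ∧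
      ∫ x in Metric.ball (0 : EuclideanSpace ℝ (Fin n)) R,
        w x ^ 2 * ∑ i, pd i (radialCutoff R τ) x ^ 2 ≤ κ := by
  obtain ⟨D, hD⟩ := exists_abs_deriv_smoothTransition_le
  set B := Metric.ball (0 : EuclideanSpace ℝ (Fin n)) R with hB
  have hBm : MeasurableSet B := Metric.isOpen_ball.measurableSet
  have hbound : ∀ τ, 0 < τ → ∀ x ∈ B,
      ‖w x ^ 2 * ∑ i, pd i (radialCutoff R τ) x ^ 2‖ ≤ 16 * L ^ 2 * D ^ 2 := by
    intro τ hτ x hx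
    have hxR : ‖x‖ < R := mem_ball_zero_iff.1 hx
    rw [Real.norm_of_nonneg (by positivity)]
    by_cases h : 2 * τ < R ^ 2 - ‖x‖ ^ 2
    · simp only [pd_radialCutoff_eq_zero _ hτ h]
      simp
      positivity
    · push Not at h
      have h1 : R - ‖x‖ ≤ 2 * τ / R := by
        rw [le_div_iff₀ hR]; nlinarith [norm_nonneg x]
      have h2 : w x ^ 2 ≤ (L * (2 * τ / R)) ^ 2 := by
        rw [← sq_abs]
        exact pow_le_pow_left₀ (abs_nonneg _)
          ((hwL x hx).trans (mul_le_mul_of_nonneg_left h1 hL)) 2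
      have h3 : ∑ i, pd i (radialCutoff R τ) x ^ 2 ≤ D ^ 2 * (4 * R ^ 2 / τ ^ 2) := by
        simp only [pd_radialCutoff, mul_pow]
        rw [← Finset.mul_sum]
        refine mul_le_mul ?_ ?_ (by positivity) (sq_nonneg D)
        · rw [← sq_abs]
          exact pow_le_pow_left₀ (abs_nonneg _) (hD _) 2
        · have : ∑ i, (-(2 * x i) / τ) ^ 2 = 4 * ‖x‖ ^ 2 / τ ^ 2 := by
            rw [EuclideanSpace.norm_sq_eq, Finset.mul_sum, Finset.sum_div]
            refine Finset.sum_congr rfl fun i _ => ?_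
            rw [Real.norm_eq_abs, sq_abs]; ring
          rw [this]
          gcongr
      calc _ ≤ (L * (2 * τ / R)) ^ 2 * (D ^ 2 * (4 * R ^ 2 / τ ^ 2)) :=
            mul_le_mul h2 h3 (by positivity) (by positivity)
        _ = _ := by field_simp; ring
  have hmeas : ∀ τ, 0 < τ → AEStronglyMeasurable
      (fun x => w x ^ 2 * ∑ i, pd i (radialCutoff R τ) x ^ 2) (volume.restrict B) := by
    intro τ hτ
    have hp : ∀ i, ContinuousOn (pd i (radialCutoff R τ)) B := fun i =>
      (isCutoff_radialCutoff hR hτ).pd.contDiff.continuous.continuousOn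
    have : ContinuousOn (fun x => w x ^ 2 * ∑ i, pd i (radialCutoff R τ) x ^ 2) B := by fun_prop
    exact this.aestronglyMeasurable hBm
  have hfin : IntegrableOn (fun _ : EuclideanSpace ℝ (Fin n) => 16 * L ^ 2 * D ^ 2) B :=
    integrableOn_const measure_ball_lt_top.ne
  have hlim : Filter.Tendsto (fun τ => ∫ x in B, w x ^ 2 * ∑ i, pd i (radialCutoff R τ) x ^ 2)
      (𝓝[>] 0) (𝓝 (∫ _x in B, (0 : ℝ))) := by
    refine tendsto_integral_filter_of_dominated_convergence (fun _ => 16 * L ^ 2 * D ^ 2)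
      (eventually_mem_nhdsWithin.mono fun τ hτ => hmeas τ hτ)
      (eventually_mem_nhdsWithin.mono fun τ hτ => ?_) hfin ?_
    · filter_upwards [ae_restrict_mem hBm] with x hx using hbound τ hτ x hx
    · filter_upwards [ae_restrict_mem hBm] with x hx
      have hxR : ‖x‖ < R := mem_ball_zero_iff.1 hx
      have hpos : 0 < R ^ 2 - ‖x‖ ^ 2 := by nlinarith [norm_nonneg x]
      refine tendsto_const_nhds.congr' ?_
      have : Ioo 0 ((R ^ 2 - ‖x‖ ^ 2) / 2) ∈ 𝓝[>] (0 : ℝ) := Ioo_mem_nhdsGT (by linarith)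
      filter_upwards [this] with τ hτ
      have h2 : 2 * τ < R ^ 2 - ‖x‖ ^ 2 := by linarith [hτ.2]
      simp [pd_radialCutoff_eq_zero _ hτ.1 h2]
  rw [integral_zero] at hlim
  obtain ⟨τ, h1, h2⟩ := ((hlim.eventually_lt_const hκ).and (Ioo_mem_nhdsGT hτ₀)).exists
  exact ⟨τ, h2.1, h2.2.le, h1.le⟩

end RadialCutoff

/-! ### The logarithmic estimate -/

section LogEstimate

variable {n : ℕ} {R R' : ℝ} {w c : EuclideanSpace ℝ (Fin n) → ℝ}

/-- Pointwise Cauchy–Schwarz inequality: `|w a + φ b|² ≤ (w² + φ² + r) (|a|² + |b|²)`. -/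
theorem sum_add_sq_div_le {w φ r : ℝ} (hr : 0 < r) (a b : Fin n → ℝ) :
    ∑ i, (w * a i + φ * b i) ^ 2 / (w ^ 2 + φ ^ 2 + r) ≤ ∑ i, a i ^ 2 + ∑ i, b i ^ 2 := by
  rw [← Finset.sum_add_distrib]
  refine Finset.sum_le_sum fun i _ => ?_
  rw [div_le_iff₀ (by positivity)]
  have := mul_nonneg hr.le (add_nonneg (sq_nonneg (a i)) (sq_nonneg (b i)))
  nlinarith [sq_nonneg (w * b i - φ * a i)]

theorem sq_mul_div_sub_le {e s A : ℝ} (he : 0 < e) (hs : 0 < s) (hA : 0 ≤ A)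
    (w : ℝ) : w ^ 2 * A / (w ^ 2 + (e + s)) - A ≤ -(e * (A / (w ^ 2 + 2 * e))) := by
  have h2 : e * (A / (w ^ 2 + 2 * e)) ≤ (e + s) * (A / (w ^ 2 + (e + s))) := by
    rw [← mul_div_assoc, ← mul_div_assoc, div_le_div_iff₀ (by positivity) (by positivity)]
    have : 0 ≤ A * (s * w ^ 2 + e * (e + s)) := by positivity
    nlinarith
  have h3 : w ^ 2 * A / (w ^ 2 + (e + s)) - A = -((e + s) * (A / (w ^ 2 + (e + s)))) := by
    field_simp
    ring
  linarith

set_option maxHeartbeats 400000 in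
/-- Logarithmic estimate for a Jacobi field `w` vanishing on the boundary of a ball: since `w` has
zero energy, testing stability with a regularization of `√(w² + ε² φ²)` bounds the Dirichlet
integral of `log (w² + 2ε²)` inside the ball uniformly in `ε`. -/
theorem exists_log_estimate (hR : 0 < R) (hR' : 0 ≤ R') (hRR' : R' < R)
    (hc : ContinuousOn c (Metric.ball 0 R))
    (hstab : ∀ ξ, IsCutoff (Metric.ball (0 : EuclideanSpace ℝ (Fin n)) R) ξ →
      ∫ x in Metric.ball 0 R, c x * ξ x ^ 2 ≤ ∫ x in Metric.ball 0 R, ∑ i, pd i ξ x ^ 2)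
    (hw : ContDiffOn ℝ ∞ w (Metric.ball 0 R))
    (hwc : ∀ x ∈ Metric.ball (0 : EuclideanSpace ℝ (Fin n)) R,
      ∑ i, pd i (pd i w) x = -(c x * w x)) {L : ℝ} (hL : 0 ≤ L)
    (hwL : ∀ x ∈ Metric.ball (0 : EuclideanSpace ℝ (Fin n)) R, |w x| ≤ L * (R - ‖x‖)) :
    ∃ C, ∀ ε : ℝ, 0 < ε →
      ∫ x in Metric.closedBall (0 : EuclideanSpace ℝ (Fin n)) R',
        (∑ i, pd i w x ^ 2) / (w x ^ 2 + 2 * ε ^ 2) ≤ C := by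
  set B := Metric.ball (0 : EuclideanSpace ℝ (Fin n)) R with hB
  set B' := Metric.closedBall (0 : EuclideanSpace ℝ (Fin n)) R' with hB'
  have hBo : IsOpen B := Metric.isOpen_ball
  have hBm : MeasurableSet B := hBo.measurableSet
  have hB'm : MeasurableSet B' := Metric.isClosed_closedBall.measurableSet
  have hsub : B' ⊆ B := Metric.closedBall_subset_ball hRR'
  obtain ⟨τ₀, hτ₀, hτ₀R⟩ : ∃ τ₀ : ℝ, 0 < τ₀ ∧ 2 * τ₀ < R ^ 2 - R' ^ 2 :=
    ⟨(R ^ 2 - R' ^ 2) / 4, by nlinarith, by nlinarith⟩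
  set φ := radialCutoff (n := n) R τ₀ with hφdef
  have hφ : IsCutoff B φ := isCutoff_radialCutoff hR hτ₀
  have hφc : ContinuousOn φ B := hφ.contDiff.continuous.continuousOn
  have hpφ : ∀ i, ContinuousOn (pd i φ) B := fun i => hφ.pd.contDiff.continuous.continuousOn
  have hwcont := hw.continuousOn
  have hpw : ∀ i, ContinuousOn (pd i w) B := fun i => (hw.pd hBo).continuousOn
  have iφ : IntegrableOn (fun x => ∑ i, pd i φ x ^ 2 + |c x| * φ x ^ 2) B :=
    hφ.integrableOn hBo (by fun_prop) fun x hx => by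
      simp [pd_eq_zero_of_notMem_tsupport hx, image_eq_zero_of_notMem_tsupport hx]
  set C₀ := ∫ x in B, (∑ i, pd i φ x ^ 2 + |c x| * φ x ^ 2) with hC₀
  refine ⟨C₀ + 2, fun ε hε => ?_⟩
  have hε2 : 0 < ε ^ 2 := by positivity
  obtain ⟨τ, hτ, hττ₀, hτw⟩ := exists_radialCutoff_integral_le (n := n) hR hL hwcont hwL hε2
    (half_pos hτ₀)
  set η := radialCutoff (n := n) R τ with hηdef
  have hη : IsCutoff B η := isCutoff_radialCutoff hR hτ
  have hηc : ContinuousOn η B := hη.contDiff.continuous.continuousOn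
  have hpη : ∀ i, ContinuousOn (pd i η) B := fun i => hη.pd.contDiff.continuous.continuousOn
  have hφη : ∀ x i, φ x * pd i η x = 0 := by
    intro x i
    rcases le_or_gt (R ^ 2 - ‖x‖ ^ 2) τ₀ with h | h
    · rw [hφdef, radialCutoff_eq_zero hτ₀ h, zero_mul]
    · rw [hηdef, pd_radialCutoff_eq_zero i hτ (by linarith), mul_zero]
  have iη : IntegrableOn (fun x => ∑ i, pd i η x ^ 2 + |c x| * η x ^ 2) B :=
    hη.integrableOn hBo (by fun_prop) fun x hx => by
      simp [pd_eq_zero_of_notMem_tsupport hx, image_eq_zero_of_notMem_tsupport hx]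
  have iwη : IntegrableOn (fun x => w x ^ 2 * ∑ i, pd i η x ^ 2) B :=
    hη.integrableOn hBo (by fun_prop) fun x hx => by simp [pd_eq_zero_of_notMem_tsupport hx]
  set W := ∫ x in B, (∑ i, pd i η x ^ 2 + |c x| * η x ^ 2) with hW
  have hW0 : 0 ≤ W := integral_nonneg fun x => by positivity
  -- `s` is so small that the contribution of the regularization is at most `ε²`
  obtain ⟨s, hs, hsW⟩ : ∃ s : ℝ, 0 < s ∧ s ^ 2 * W ≤ ε ^ 2 := by
    refine ⟨ε / √(1 + W), by positivity, ?_⟩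
    rw [div_pow, Real.sq_sqrt (by linarith), div_mul_eq_mul_div, div_le_iff₀ (by linarith)]
    nlinarith
  have hs2 : 0 < s ^ 2 := by positivity
  set ψ := fun x => ε ^ 2 * φ x ^ 2 + s ^ 2 with hψ
  have hφd : ∀ x, DifferentiableAt ℝ φ x := fun x => hφ.contDiff.differentiable (by simp) x
  have hψs : ContDiffOn ℝ ∞ ψ B :=
    ((contDiff_const.mul (hφ.contDiff.pow 2)).add contDiff_const).contDiffOn
  have hpψ : ∀ i x, pd i ψ x = 2 * ε ^ 2 * (φ x * pd i φ x) := by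
    intro i x
    have h1 : DifferentiableAt ℝ (fun x => φ x ^ 2) x := (hφd x).pow 2
    rw [hψ, pd_add (h1.const_mul _) (differentiableAt_const _), pd_const,
      pd_mul (differentiableAt_const _) h1, pd_const, pd_sq (hφd x)]
    ring
  have key := stability_of_jacobi (ι := Unit) hBo hc hstab hη (J := fun _ => w) (fun _ => hw)
    (fun _ => hwc) hψs (fun x _ => by simp only [hψ]; positivity)
  simp only [Finset.univ_unique, Finset.sum_singleton] at key
  have hEc : ContinuousOn (fun x => (∑ i, pd i w x ^ 2) / (w x ^ 2 + 2 * ε ^ 2)) B := by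
    refine ContinuousOn.div (by fun_prop) (by fun_prop) fun x _ => ?_
    positivity
  have iE : IntegrableOn (fun x => (∑ i, pd i w x ^ 2) / (w x ^ 2 + 2 * ε ^ 2)) B' :=
    (hEc.mono hsub).integrableOn_compact (isCompact_closedBall _ _)
  set E := fun x => (∑ i, pd i w x ^ 2) / (w x ^ 2 + 2 * ε ^ 2) with hE
  have iE' : IntegrableOn (B'.indicator E) B :=
    ((integrable_indicator_iff hB'm).2 iE).integrableOn
  have hEint : ∫ x in B, B'.indicator E x = ∫ x in B', E x := by
    rw [setIntegral_indicator hB'm, inter_eq_right.2 hsub]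
  have hE0 : ∀ x, 0 ≤ E x := fun x => by simp only [hE]; positivity
  have hpt : ∀ x ∈ B, η x ^ 2 * ∑ i, (w x * pd i w x + pd i ψ x / 2) ^ 2 / (w x ^ 2 + ψ x)
        + (w x ^ 2 + ψ x) * ∑ i, pd i η x ^ 2
        + η x * ∑ i, pd i η x * pd i ψ x - c x * (η x ^ 2 * ψ x)
        - η x ^ 2 * ∑ i, pd i w x ^ 2
      ≤ (-(ε ^ 2) * B'.indicator E x + ε ^ 2 * (∑ i, pd i φ x ^ 2 + |c x| * φ x ^ 2))
        + (w x ^ 2 * ∑ i, pd i η x ^ 2 + s ^ 2 * (∑ i, pd i η x ^ 2 + |c x| * η x ^ 2)) := by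
    intro x _
    have hη1 : η x ^ 2 ≤ 1 := radialCutoff_sq_le_one x
    have e1 : ∑ i, pd i η x * pd i ψ x = 0 := Finset.sum_eq_zero fun i _ => by
      rw [hpψ]; linear_combination (2 * ε ^ 2 * pd i φ x) * hφη x i
    have e2 : ψ x * ∑ i, pd i η x ^ 2 = s ^ 2 * ∑ i, pd i η x ^ 2 := by
      have : φ x ^ 2 * ∑ i, pd i η x ^ 2 = 0 := by
        rw [Finset.mul_sum]
        exact Finset.sum_eq_zero fun i _ => by rw [← mul_pow, hφη, zero_pow two_ne_zero]
      simp only [hψ]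
      linear_combination ε ^ 2 * this
    have e3 : -(c x * (η x ^ 2 * ψ x)) ≤ ε ^ 2 * (|c x| * φ x ^ 2) + s ^ 2 * (|c x| * η x ^ 2) := by
      have h1 : -(c x * (η x ^ 2 * ψ x)) ≤ |c x| * (η x ^ 2 * ψ x) := by
        have h0 : 0 ≤ η x ^ 2 * ψ x := by simp only [hψ]; positivity
        nlinarith [mul_le_mul_of_nonneg_right (neg_abs_le (c x)) h0]
      have h2 : |c x| * (ε ^ 2 * (η x ^ 2 * φ x ^ 2)) ≤ |c x| * (ε ^ 2 * (1 * φ x ^ 2)) := by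
        gcongr
      have h3 : |c x| * (η x ^ 2 * ψ x)
          = |c x| * (ε ^ 2 * (η x ^ 2 * φ x ^ 2)) + s ^ 2 * (|c x| * η x ^ 2) := by
        simp only [hψ]; ring
      linarith
    have e4 : η x ^ 2 * ∑ i, (w x * pd i w x + pd i ψ x / 2) ^ 2 / (w x ^ 2 + ψ x)
        - η x ^ 2 * ∑ i, pd i w x ^ 2
        ≤ -(ε ^ 2) * B'.indicator E x + ε ^ 2 * ∑ i, pd i φ x ^ 2 := by
      by_cases hx' : x ∈ B'
      · have hxR : ‖x‖ ≤ R' := mem_closedBall_zero_iff.1 hx'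
        have hxR2 : 2 * τ₀ < R ^ 2 - ‖x‖ ^ 2 := by nlinarith [norm_nonneg x]
        have hφ1 : φ x = 1 := radialCutoff_eq_one hτ₀ hxR2.le
        have hη1 : η x = 1 := radialCutoff_eq_one hτ (by linarith)
        have hφ0 : ∀ i, pd i φ x = 0 := fun i => pd_radialCutoff_eq_zero i hτ₀ hxR2
        have hψ0 : ∀ i, pd i ψ x = 0 := fun i => by rw [hpψ, hφ0]; ring
        have hψ1 : ψ x = ε ^ 2 + s ^ 2 := by simp only [hψ, hφ1]; ring
        rw [indicator_of_mem hx', hη1, hψ1]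
        simp only [hψ0, hφ0, hE, zero_div, add_zero, mul_pow]
        rw [← Finset.sum_div, ← Finset.mul_sum]
        have hA : 0 ≤ ∑ i, pd i w x ^ 2 := by positivity
        generalize ∑ i, pd i w x ^ 2 = A at *
        simpa using sq_mul_div_sub_le hε2 hs2 hA (w x)
      · rw [indicator_of_notMem hx']
        have h := sum_add_sq_div_le (w := w x) (φ := ε * φ x) hs2 (fun i => pd i w x)
          (fun i => ε * pd i φ x)
        have h1 : ∑ i, (w x * pd i w x + ε * φ x * (ε * pd i φ x)) ^ 2
              / (w x ^ 2 + (ε * φ x) ^ 2 + s ^ 2)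
            = ∑ i, (w x * pd i w x + pd i ψ x / 2) ^ 2 / (w x ^ 2 + ψ x) := by
          refine Finset.sum_congr rfl fun i _ => ?_
          rw [hpψ]
          simp only [hψ]
          congr 1 <;> ring
        have h2 : ∑ i, (ε * pd i φ x) ^ 2 = ε ^ 2 * ∑ i, pd i φ x ^ 2 := by
          simp only [mul_pow, Finset.mul_sum]
        rw [h1, h2] at h
        have h3 : 0 ≤ ε ^ 2 * ∑ i, pd i φ x ^ 2 := by positivity
        have h4 := mul_le_mul_of_nonneg_left h (sq_nonneg (η x))
        have h5 := mul_le_mul_of_nonneg_right hη1 h3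
        linarith
    rw [e1, add_mul, e2]
    linarith
  have iR1 : IntegrableOn (fun x => -(ε ^ 2) * B'.indicator E x
      + ε ^ 2 * (∑ i, pd i φ x ^ 2 + |c x| * φ x ^ 2)) B :=
    (iE'.const_mul _).add (iφ.const_mul _)
  have iR2 : IntegrableOn (fun x => w x ^ 2 * ∑ i, pd i η x ^ 2
      + s ^ 2 * (∑ i, pd i η x ^ 2 + |c x| * η x ^ 2)) B := iwη.add (iη.const_mul _)
  have hle := key.trans (setIntegral_mono_on ?_ (iR1.add iR2) hBm hpt)
  · simp only [Pi.add_apply] at hle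
    rw [integral_add iR1 iR2, integral_add (iE'.const_mul _) (iφ.const_mul _),
      integral_add iwη (iη.const_mul _), integral_const_mul, integral_const_mul,
      integral_const_mul, hEint] at hle
    have h : ε ^ 2 * ∫ x in B', E x ≤ ε ^ 2 * (C₀ + 2) := by linarith
    exact le_of_mul_le_mul_left h hε2
  · have hψc : ContinuousOn ψ B := hψs.continuousOn
    have hpψc : ∀ i, ContinuousOn (pd i ψ) B := fun i => (hψs.pd hBo).continuousOn
    refine hη.integrableOn hBo ?_ fun x hx => by
      simp [pd_eq_zero_of_notMem_tsupport hx, image_eq_zero_of_notMem_tsupport hx]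
    have hdiv : ∀ i, ContinuousOn
        (fun x => (w x * pd i w x + pd i ψ x / 2) ^ 2 / (w x ^ 2 + ψ x)) B := fun i =>
      ContinuousOn.div (by fun_prop) (by fun_prop) fun x _ => by
        simp only [hψ]; positivity
    fun_prop

end LogEstimate

/-! ### Radial symmetry of stable solutions in a ball -/

section Radial

variable {n : ℕ} {R R' : ℝ} {i j : Fin n} {u c w : EuclideanSpace ℝ (Fin n) → ℝ}
  {x : EuclideanSpace ℝ (Fin n)}

theorem hasDerivAt_comp_rot (hij : i ≠ j) {F : EuclideanSpace ℝ (Fin n) → ℝ} {θ : ℝ}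
    (hF : DifferentiableAt ℝ F (rot i j θ x)) :
    HasDerivAt (fun t => F (rot i j t x)) (angDeriv i j F (rot i j θ x)) θ := by
  have h := hF.hasFDerivAt.comp_hasDerivAt θ (hasDerivAt_rot hij x θ)
  rw [fderiv_rotVec] at h
  exact h

theorem rot_mem_closedBall (hij : i ≠ j) (θ : ℝ)
    (hx : x ∈ Metric.closedBall (0 : EuclideanSpace ℝ (Fin n)) R') :
    rot i j θ x ∈ Metric.closedBall (0 : EuclideanSpace ℝ (Fin n)) R' := by
  rw [mem_closedBall_zero_iff] at hx ⊢
  rwa [norm_rot hij]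

/-- The angular derivative vanishes somewhere on each orbit of the rotations, by periodicity. -/
theorem exists_angDeriv_rot_eq_zero (hij : i ≠ j)
    (hu : ∀ θ, DifferentiableAt ℝ u (rot i j θ x)) :
    ∃ θ ∈ Ioo 0 (2 * Real.pi), angDeriv i j u (rot i j θ x) = 0 := by
  have hd : ∀ θ, HasDerivAt (fun t => u (rot i j t x)) (angDeriv i j u (rot i j θ x)) θ :=
    fun θ => hasDerivAt_comp_rot hij (hu θ)
  exact exists_hasDerivAt_eq_zero Real.two_pi_pos
    (fun θ _ => (hd θ).continuousAt.continuousWithinAt)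
    (by rw [rot_zero, rot_two_pi]) fun θ _ => hd θ

theorem abs_angDeriv_log_le {d : ℝ} (hd : 0 < d) (hw : DifferentiableAt ℝ w x)
    (hx : ‖x‖ ≤ R) :
    |angDeriv i j (fun x => Real.log (1 + w x ^ 2 / d)) x| ≤
      2 * (R ^ 2 + (∑ k, pd k w x ^ 2) / (w x ^ 2 + d)) := by
  have hlog : HasDerivAt (fun t : ℝ => Real.log (1 + t ^ 2 / d)) (2 * w x / (w x ^ 2 + d))
      (w x) := by
    have h1 : HasDerivAt (fun t : ℝ => 1 + t ^ 2 / d) (2 * w x / d) (w x) := by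
      simpa using ((hasDerivAt_pow 2 (w x)).div_const d).const_add 1
    refine (h1.log (by positivity)).congr_deriv ?_
    field_simp
    ring
  have hp : ∀ k, pd k (fun x => Real.log (1 + w x ^ 2 / d)) x
      = 2 * w x / (w x ^ 2 + d) * pd k w x := fun k => pd_comp hlog hw
  have hq : 0 < w x ^ 2 + d := by positivity
  have hcoord : ∀ k, x k ^ 2 ≤ R ^ 2 := fun k => by
    have h := PiLp.norm_apply_le x k
    rw [← sq_abs]
    exact pow_le_pow_left₀ (abs_nonneg _) (h.trans hx) 2
  have hterm : ∀ k l, |x k * (2 * w x / (w x ^ 2 + d) * pd l w x)| ≤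
      R ^ 2 + (∑ k, pd k w x ^ 2) / (w x ^ 2 + d) := by
    intro k l
    have hl : pd l w x ^ 2 ≤ ∑ k, pd k w x ^ 2 :=
      Finset.single_le_sum (f := fun k => pd k w x ^ 2) (fun k _ => sq_nonneg _)
        (Finset.mem_univ l)
    have e1 : x k * (2 * w x / (w x ^ 2 + d) * pd l w x)
        = (2 * (x k * w x) * pd l w x) / (w x ^ 2 + d) := by ring
    have e2 : R ^ 2 + (∑ k, pd k w x ^ 2) / (w x ^ 2 + d)
        = (R ^ 2 * (w x ^ 2 + d) + ∑ k, pd k w x ^ 2) / (w x ^ 2 + d) := by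
      field_simp
    rw [e1, e2, abs_div, abs_of_pos hq]
    refine div_le_div_of_nonneg_right ?_ hq.le
    have h1 : x k ^ 2 * w x ^ 2 ≤ R ^ 2 * w x ^ 2 :=
      mul_le_mul_of_nonneg_right (hcoord k) (sq_nonneg _)
    have h2 : 0 ≤ R ^ 2 * d := by positivity
    rw [abs_le]
    constructor <;>
      nlinarith [sq_nonneg (x k * w x - pd l w x), sq_nonneg (x k * w x + pd l w x)]
  rw [angDeriv, hp, hp]
  calc _ ≤ _ := abs_sub _ _
    _ ≤ _ := add_le_add (hterm i j) (hterm j i)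
    _ = _ := by ring

theorem continuous_rot : Continuous fun p : EuclideanSpace ℝ (Fin n) × ℝ => rot i j p.2 p.1 := by
  have h : ∀ k, Continuous fun p : EuclideanSpace ℝ (Fin n) × ℝ => p.1 k := fun k => by fun_prop
  simp only [rot_apply]
  exact (continuous_fst.add
    ((((Real.continuous_cos.comp continuous_snd).sub continuous_const).mul (h i)).sub
      ((Real.continuous_sin.comp continuous_snd).mul (h j)) |>.smul continuous_const)).add
    ((((Real.continuous_cos.comp continuous_snd).sub continuous_const).mul (h j)).add
      ((Real.continuous_sin.comp continuous_snd).mul (h i)) |>.smul continuous_const)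

theorem continuous_rot_angle (x : EuclideanSpace ℝ (Fin n)) : Continuous fun θ => rot i j θ x :=
  continuous_iff_continuousAt.2 fun θ =>
    continuous_rot.continuousAt.comp (x := θ) (f := fun θ => (x, θ)) (by fun_prop)

/-- A function that vanishes somewhere on the orbit of `x` is bounded at `x` by the integral of its
angular derivative along the orbit. -/
theorem le_setIntegral_rot (hij : i ≠ j) (hRR' : R' < R) {G H : EuclideanSpace ℝ (Fin n) → ℝ}
    (hG : ContDiffOn ℝ ∞ G (Metric.ball 0 R)) (hH : ContinuousOn H (Metric.closedBall 0 R'))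
    (hGH : ∀ z ∈ Metric.closedBall (0 : EuclideanSpace ℝ (Fin n)) R', |angDeriv i j G z| ≤ H z)
    (hx : x ∈ Metric.closedBall (0 : EuclideanSpace ℝ (Fin n)) R') {θ₀ : ℝ}
    (hθ₀ : θ₀ ∈ Ioo 0 (2 * Real.pi)) (h0 : G (rot i j θ₀ x) = 0) :
    G x ≤ ∫ θ in Icc 0 (2 * Real.pi), H (rot i j θ x) := by
  have hBo : IsOpen (Metric.ball (0 : EuclideanSpace ℝ (Fin n)) R) := Metric.isOpen_ball
  have hmem' : ∀ θ, rot i j θ x ∈ Metric.closedBall (0 : EuclideanSpace ℝ (Fin n)) R' :=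
    fun θ => rot_mem_closedBall hij θ hx
  have hmem : ∀ θ, rot i j θ x ∈ Metric.ball (0 : EuclideanSpace ℝ (Fin n)) R :=
    fun θ => Metric.closedBall_subset_ball hRR' (hmem' θ)
  have hd : ∀ θ, HasDerivAt (fun t => G (rot i j t x)) (angDeriv i j G (rot i j θ x)) θ :=
    fun θ => hasDerivAt_comp_rot hij (hG.differentiableAt_of_isOpen hBo (hmem θ))
  have hac : Continuous fun θ => angDeriv i j G (rot i j θ x) :=
    (contDiffOn_angDeriv hBo hG).continuousOn.comp_continuous (continuous_rot_angle x) hmem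
  have hHc : Continuous fun θ => H (rot i j θ x) :=
    hH.comp_continuous (continuous_rot_angle x) hmem'
  have hH0 : ∀ θ, 0 ≤ H (rot i j θ x) := fun θ => (abs_nonneg _).trans (hGH _ (hmem' θ))
  have hftc := intervalIntegral.integral_eq_sub_of_hasDerivAt (a := 0) (b := θ₀)
    (fun θ _ => hd θ) (hac.intervalIntegrable _ _)
  rw [h0, rot_zero, zero_sub] at hftc
  have hsub2 : Ioc 0 θ₀ ⊆ Icc 0 (2 * Real.pi) := fun t ht => ⟨ht.1.le, ht.2.trans hθ₀.2.le⟩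
  have hHi : IntegrableOn (fun θ => H (rot i j θ x)) (Icc 0 (2 * Real.pi)) :=
    hHc.continuousOn.integrableOn_compact isCompact_Icc
  calc G x = -∫ θ in Ioc 0 θ₀, angDeriv i j G (rot i j θ x) := by
        rw [← intervalIntegral.integral_of_le hθ₀.1.le, hftc, neg_neg]
    _ = ∫ θ in Ioc 0 θ₀, -angDeriv i j G (rot i j θ x) := by rw [integral_neg]
    _ ≤ ∫ θ in Ioc 0 θ₀, H (rot i j θ x) :=
        setIntegral_mono (hac.neg.integrableOn_Ioc) (hHi.mono_set hsub2)
          fun θ => (neg_le_abs _).trans (hGH _ (hmem' θ))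
    _ ≤ ∫ θ in Icc 0 (2 * Real.pi), H (rot i j θ x) :=
        setIntegral_mono_set hHi (Filter.Eventually.of_forall hH0) hsub2.eventuallyLE

theorem setIntegral_setIntegral_rot (hij : i ≠ j) {H : EuclideanSpace ℝ (Fin n) → ℝ}
    (hH : ContinuousOn H (Metric.closedBall 0 R')) :
    IntegrableOn (fun x => ∫ θ in Icc 0 (2 * Real.pi), H (rot i j θ x)) (Metric.closedBall 0 R') ∧
    ∫ x in Metric.closedBall 0 R', ∫ θ in Icc 0 (2 * Real.pi), H (rot i j θ x)
      = 2 * Real.pi * ∫ x in Metric.closedBall 0 R', H x := by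
  have hint : Integrable (Function.uncurry fun x θ => H (rot i j θ x))
      ((volume.restrict (Metric.closedBall (0 : EuclideanSpace ℝ (Fin n)) R')).prod
        (volume.restrict (Icc 0 (2 * Real.pi)))) := by
    rw [Measure.prod_restrict]
    refine ContinuousOn.integrableOn_compact ((isCompact_closedBall _ _).prod isCompact_Icc) ?_
    exact hH.comp (continuous_rot (i := i) (j := j)).continuousOn
      fun p hp => rot_mem_closedBall hij p.2 hp.1
  refine ⟨hint.integral_prod_left, (integral_integral_swap hint).trans ?_⟩
  have hθ : ∀ θ, ∫ x in Metric.closedBall 0 R', H (rot i j θ x)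
      = ∫ x in Metric.closedBall 0 R', H x := by
    intro θ
    have hpre : rotEquiv hij θ ⁻¹' Metric.closedBall 0 R' = Metric.closedBall 0 R' := by
      ext x
      simp only [mem_preimage, mem_closedBall_zero_iff, LinearIsometryEquiv.norm_map]
    have := (rotEquiv hij θ).measurePreserving.setIntegral_preimage_emb
      (rotEquiv hij θ).toHomeomorph.measurableEmbedding H (Metric.closedBall 0 R')
    rw [hpre] at this
    exact this
  simp only [hθ]
  rw [setIntegral_const]
  simp [Real.pi_pos.le]

/-- The integral of `log (1 + w² / d)` over a ball is bounded by that of its angular derivative, as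
`w` vanishes somewhere on each orbit of the rotations. -/
theorem integral_log_le (hij : i ≠ j) (hRR' : R' < R)
    (hw : ContDiffOn ℝ ∞ w (Metric.ball (0 : EuclideanSpace ℝ (Fin n)) R))
    (h0 : ∀ x ∈ Metric.closedBall (0 : EuclideanSpace ℝ (Fin n)) R',
      ∃ θ ∈ Ioo 0 (2 * Real.pi), w (rot i j θ x) = 0) {d : ℝ} (hd : 0 < d) :
    ∫ x in Metric.closedBall (0 : EuclideanSpace ℝ (Fin n)) R', Real.log (1 + w x ^ 2 / d) ≤
      2 * Real.pi * ∫ x in Metric.closedBall (0 : EuclideanSpace ℝ (Fin n)) R',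
        2 * (R ^ 2 + (∑ k, pd k w x ^ 2) / (w x ^ 2 + d)) := by
  have hBo : IsOpen (Metric.ball (0 : EuclideanSpace ℝ (Fin n)) R) := Metric.isOpen_ball
  have hsub := Metric.closedBall_subset_ball (x := (0 : EuclideanSpace ℝ (Fin n))) hRR'
  have hwc := hw.continuousOn
  have hpw : ∀ k, ContinuousOn (pd k w) (Metric.ball 0 R) := fun k => (hw.pd hBo).continuousOn
  have hHc : ContinuousOn (fun x => 2 * (R ^ 2 + (∑ k, pd k w x ^ 2) / (w x ^ 2 + d)))
      (Metric.closedBall 0 R') := by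
    refine ContinuousOn.mono ?_ hsub
    refine continuousOn_const.mul (continuousOn_const.add (ContinuousOn.div ?_ ?_ fun x _ => ?_))
    · fun_prop
    · fun_prop
    · positivity
  have hGs : ContDiffOn ℝ ∞ (fun x => Real.log (1 + w x ^ 2 / d)) (Metric.ball 0 R) := by
    refine ContDiffOn.log (contDiffOn_const.add ((hw.pow 2).div_const d)) fun x _ => ?_
    have : 0 ≤ w x ^ 2 / d := by positivity
    positivity
  obtain ⟨hi, heq⟩ := setIntegral_setIntegral_rot hij hHc
  rw [← heq]
  refine setIntegral_mono_on
    ((hGs.continuousOn.mono hsub).integrableOn_compact (isCompact_closedBall _ _)) hi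
    Metric.isClosed_closedBall.measurableSet fun x hx => ?_
  obtain ⟨θ₀, hθ₀, hwθ₀⟩ := h0 x hx
  refine le_setIntegral_rot hij hRR' hGs hHc (fun z hz => ?_) hx hθ₀ (by simp [hwθ₀])
  exact abs_angDeriv_log_le hd (hw.differentiableAt_of_isOpen hBo (hsub hz))
    (mem_ball_zero_iff.1 (hsub hz)).le

/-- A function whose logarithms `log (1 + w² / d)` have integrals over a ball bounded uniformly
as `d → 0` vanishes. -/
theorem eq_zero_of_integral_log_le (hw : ContinuousOn w (Metric.closedBall 0 R')) {M : ℝ}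
    (hM : ∀ ε, 0 < ε → ∫ x in Metric.closedBall (0 : EuclideanSpace ℝ (Fin n)) R',
      Real.log (1 + w x ^ 2 / (2 * ε ^ 2)) ≤ M) :
    ∀ x ∈ Metric.ball (0 : EuclideanSpace ℝ (Fin n)) R', w x = 0 := by
  intro x hx
  by_contra hne
  set B' := Metric.closedBall (0 : EuclideanSpace ℝ (Fin n)) R' with hB'
  set m := |w x| / 2 with hm
  have hm0 : 0 < m := by have := abs_pos.2 hne; positivity
  have hwx : ContinuousAt w x := hw.continuousAt
    (Filter.mem_of_superset (Metric.isOpen_ball.mem_nhds hx) Metric.ball_subset_closedBall)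
  have hev : ∀ᶠ z in 𝓝 x, m < |w z| ∧ z ∈ B' :=
    (hwx.abs.eventually_const_lt (by rw [hm]; linarith)).and
      (Filter.mem_of_superset (Metric.isOpen_ball.mem_nhds hx) Metric.ball_subset_closedBall)
  obtain ⟨r, hr, hball⟩ := Metric.eventually_nhds_iff_ball.1 hev
  set V := volume.real (Metric.ball x r) with hV
  have hV0 : 0 < V := ENNReal.toReal_pos (Metric.measure_ball_pos _ _ hr).ne'
    measure_ball_lt_top.ne
  have hlow : ∀ ε, 0 < ε → V * Real.log (1 + m ^ 2 / (2 * ε ^ 2)) ≤ M := by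
    intro ε hε
    refine le_trans ?_ (hM ε hε)
    have hi : IntegrableOn (fun x => Real.log (1 + w x ^ 2 / (2 * ε ^ 2))) B' := by
      refine ContinuousOn.integrableOn_compact (isCompact_closedBall _ _) ?_
      exact ContinuousOn.log (by fun_prop) fun x _ => by positivity
    have hnn : ∀ x, 0 ≤ Real.log (1 + w x ^ 2 / (2 * ε ^ 2)) := fun x =>
      Real.log_nonneg (by have : 0 ≤ w x ^ 2 / (2 * ε ^ 2) := by positivity
                          linarith)
    have hsub : Metric.ball x r ⊆ B' := fun z hz => (hball z hz).2
    calc V * Real.log (1 + m ^ 2 / (2 * ε ^ 2))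
        = ∫ _z in Metric.ball x r, Real.log (1 + m ^ 2 / (2 * ε ^ 2)) := by
          rw [setIntegral_const, smul_eq_mul]
      _ ≤ ∫ z in Metric.ball x r, Real.log (1 + w z ^ 2 / (2 * ε ^ 2)) := by
          refine setIntegral_mono_on (integrableOn_const measure_ball_lt_top.ne)
            (hi.mono_set hsub) Metric.isOpen_ball.measurableSet fun z hz => ?_
          have h1 : m ^ 2 ≤ w z ^ 2 := by
            rw [← sq_abs (w z)]
            exact pow_le_pow_left₀ hm0.le (hball z hz).1.le 2
          gcongr
      _ ≤ _ := setIntegral_mono_set hi (Filter.Eventually.of_forall hnn) hsub.eventuallyLE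
  -- the choice of `ε` for which the left side of `hlow` is `V (|M| / V + 1)`
  set t := Real.exp (|M| / V + 1) with ht
  have ht1 : 1 < t := Real.one_lt_exp_iff.2 (by positivity)
  have h := hlow (m / √(2 * (t - 1))) (by
    have : 0 < 2 * (t - 1) := by linarith
    positivity)
  have ht0 : (0 : ℝ) < t - 1 := by linarith
  have e : 1 + m ^ 2 / (2 * (m / √(2 * (t - 1))) ^ 2) = t := by
    rw [div_pow m, Real.sq_sqrt (by linarith : 0 ≤ 2 * (t - 1))]
    field_simp
    ring
  rw [e, ht, Real.log_exp, mul_add, mul_div_cancel₀ _ hV0.ne'] at h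
  linarith [le_abs_self M]

/-- A stable solution in a ball with vanishing boundary values is radial. -/
theorem angDeriv_eq_zero (hR : 0 < R)
    (hst : IsStableWithPotential (Metric.ball (0 : EuclideanSpace ℝ (Fin n)) R) u c)
    (hu : ContDiffOn ℝ ∞ u (closure (Metric.ball (0 : EuclideanSpace ℝ (Fin n)) R)))
    (hu0 : ∀ x ∈ frontier (Metric.ball (0 : EuclideanSpace ℝ (Fin n)) R), u x = 0)
    (hx : x ∈ Metric.ball (0 : EuclideanSpace ℝ (Fin n)) R) : angDeriv i j u x = 0 := by
  by_cases hij : i = j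
  · simp [angDeriv, hij]
  have hxR : ‖x‖ < R := mem_ball_zero_iff.1 hx
  obtain ⟨R', hxR', hR'R⟩ := exists_between hxR
  have hR' : 0 ≤ R' := (norm_nonneg x).trans hxR'.le
  have hw : ContDiffOn ℝ ∞ (angDeriv i j u) (Metric.ball 0 R) :=
    contDiffOn_angDeriv hst.isOpen hst.smooth
  have hsub : Metric.closedBall (0 : EuclideanSpace ℝ (Fin n)) R' ⊆ Metric.ball 0 R :=
    Metric.closedBall_subset_ball hR'R
  obtain ⟨L, hL, hwL⟩ := exists_abs_angDeriv_le hR hu hu0 hij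
  obtain ⟨C, hC⟩ := exists_log_estimate hR hR' hR'R hst.continuousOn hst.stable hw
    (fun z hz => hst.jacobi_angDeriv hz) hL hwL
  have hpw : ∀ k, ContinuousOn (pd k (angDeriv i j u)) (Metric.ball 0 R) :=
    fun k => (hw.pd hst.isOpen).continuousOn
  have hwc := hw.continuousOn
  refine eq_zero_of_integral_log_le (R' := R') (hw.continuousOn.mono hsub)
    (M := 2 * Real.pi * (2 * (R ^ 2 *
      volume.real (Metric.closedBall (0 : EuclideanSpace ℝ (Fin n)) R') + C)))
    (fun ε hε => ?_) x (mem_ball_zero_iff.2 hxR')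
  have hd : 0 < 2 * ε ^ 2 := by positivity
  have h := integral_log_le hij hR'R hw (fun z hz => exists_angDeriv_rot_eq_zero hij fun θ =>
    hst.smooth.differentiableAt_of_isOpen hst.isOpen (hsub (rot_mem_closedBall hij θ hz))) hd
  refine h.trans (mul_le_mul_of_nonneg_left ?_ Real.two_pi_pos.le)
  have hi : IntegrableOn (fun x => (∑ k, pd k (angDeriv i j u) x ^ 2)
      / (angDeriv i j u x ^ 2 + 2 * ε ^ 2)) (Metric.closedBall 0 R') := by
    refine ContinuousOn.integrableOn_compact (isCompact_closedBall _ _) (ContinuousOn.mono ?_ hsub)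
    exact ContinuousOn.div (by fun_prop) (by fun_prop) fun x _ => by positivity
  have hi0 : IntegrableOn (fun _ : EuclideanSpace ℝ (Fin n) => R ^ 2) (Metric.closedBall 0 R') :=
    integrableOn_const measure_closedBall_lt_top.ne
  rw [integral_const_mul, integral_add hi0 hi, setIntegral_const, smul_eq_mul, mul_comm (volume.real _)]
  linarith [hC ε hε]

end Radial

/-! ### The estimate in balls -/

section RadialEstimate

variable {n : ℕ} {Ω : Set (EuclideanSpace ℝ (Fin n))} {u : EuclideanSpace ℝ (Fin n) → ℝ}
  {x : EuclideanSpace ℝ (Fin n)} {R α δ ε s : ℝ}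

/-- For a radial function the level sets are spheres, whose mean curvature bounds the left side of
the stability inequality from below. The tangential field of `u` vanishes identically, hence so does
its divergence. -/
theorem gradSq_le_of_angDeriv_eq_zero (hΩ : IsOpen Ω) (hn : 2 ≤ n) (hu : ContDiffOn ℝ ∞ u Ω)
    (hrad : ∀ i j, ∀ z ∈ Ω, angDeriv i j u z = 0) (hx : x ∈ Ω) (hs : 0 < s) :
    (n - 1) * gradSq u x ≤ regDistSq 0 ε x * regHess u s x := by
  have hn1 : (0 : ℝ) < n - 1 := by
    have : (2 : ℝ) ≤ n := by exact_mod_cast hn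
    linarith
  have hV : ∀ i, ∀ z ∈ Ω, tangentialField u 0 i z = 0 := by
    intro i z hz
    have : tangentialField u 0 i z = ∑ k, pd k u z * angDeriv i k u z := by
      simp only [tangentialField, gradSq, angDeriv, PiLp.zero_apply, sub_zero]
      rw [Finset.sum_mul, Finset.sum_mul, ← Finset.sum_sub_distrib]
      exact Finset.sum_congr rfl fun k _ => by ring
    rw [this]
    exact Finset.sum_eq_zero fun k _ => by rw [hrad i k z hz, mul_zero]
  have hdiv := sum_pd_tangentialField (y := 0) hΩ hu hx
  have h0 : ∑ i, pd i (tangentialField u 0 i) x = 0 := Finset.sum_eq_zero fun i _ => by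
    have : tangentialField u 0 i =ᶠ[𝓝 x] fun _ => 0 := by
      filter_upwards [hΩ.mem_nhds hx] with z hz using hV i z hz
    rw [pd_congr this, pd_const]
  rw [h0] at hdiv
  have hla := sq_sub_trace_le hn (D := fun i j => pd i (pd j u) x)
    (fun i j => pd_comm hΩ hu hx) (fun j => pd j u x)
    (fun i => x i - (0 : EuclideanSpace ℝ (Fin n)) i) s
  simp only at hla
  rw [← regHess, ← gradSq, eq_neg_of_add_eq_zero_right hdiv.symm] at hla
  have hG := gradSq_nonneg (u := u) x
  have hN := regHess_nonneg (u := u) hs x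
  have hz : ∑ i, (x i - (0 : EuclideanSpace ℝ (Fin n)) i) ^ 2 ≤ regDistSq 0 ε x := by
    rw [regDistSq]; linarith [sq_nonneg ε]
  have hZ0 : 0 ≤ ∑ i, (x i - (0 : EuclideanSpace ℝ (Fin n)) i) ^ 2 := by positivity
  generalize ∑ i, (x i - (0 : EuclideanSpace ℝ (Fin n)) i) ^ 2 = Z at *
  rcases hG.eq_or_lt with h | h
  · rw [← h, mul_zero]
    exact mul_nonneg (hZ0.trans hz) hN
  · have h1 : (n - 1) * gradSq u x ≤ Z * regHess u s x := by
      have h2 : ((n - 1) * gradSq u x) * ((n - 1) * gradSq u x)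
          ≤ ((n - 1) * gradSq u x) * (Z * regHess u s x) := by
        linarith
      exact le_of_mul_le_mul_left h2 (mul_pos hn1 h)
    exact h1.trans (mul_le_mul_of_nonneg_right hz hN)

theorem innerSet_anti {δ' : ℝ} (h : δ' ≤ δ) : innerSet Ω δ ⊆ innerSet Ω δ' :=
  fun _ hx => ⟨hx.1, h.trans hx.2⟩

theorem zero_mem_innerSet_ball (hn : 2 ≤ n) (hR : 0 < R) (hδ : δ ≤ R) :
    (0 : EuclideanSpace ℝ (Fin n)) ∈ innerSet (Metric.ball 0 R) δ := by
  refine ⟨Metric.mem_ball_self hR, ?_⟩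
  rw [frontier_ball _ hR.ne']
  have hne : (Metric.sphere (0 : EuclideanSpace ℝ (Fin n)) R).Nonempty :=
    ⟨EuclideanSpace.single ⟨0, by omega⟩ R, by simp [abs_of_pos hR]⟩
  rw [Metric.le_infDist hne]
  intro z hz
  rw [dist_comm, Metric.mem_sphere.1 hz]
  exact hδ

/-- The estimate at the center of a ball, for solutions vanishing on the boundary. It rests on the
radial symmetry of `u`, and the factor that is absorbed is `(α - 2)² / 4 / (n - 1)`. -/
theorem exists_weightedGradientBound_ball (hα₀ : 0 ≤ α) (hα₁ : α < (n : ℝ) - 1)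
    (hα : (α - 2) ^ 2 / 4 < (n : ℝ) - 1) (hR : 0 < R) (hδ : 0 < δ) :
    ∃ C : ℝ, ∀ (f : ℝ → ℝ) (u : EuclideanSpace ℝ (Fin n) → ℝ),
      ContDiff ℝ 1 f → IsSmoothSolution (Metric.ball 0 R) f u →
      (∀ x ∈ frontier (Metric.ball (0 : EuclideanSpace ℝ (Fin n)) R), u x = 0) →
      IsStable (Metric.ball 0 R) f u →
      WeightedGradientBound (Metric.ball 0 R) α δ C u 0 := by
  have hn1 : (0 : ℝ) < n - 1 := hα₀.trans_lt hα₁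
  have hn : 2 ≤ n := by
    have : (1 : ℝ) < n := by linarith
    exact_mod_cast this
  have hΩ : IsOpen (Metric.ball (0 : EuclideanSpace ℝ (Fin n)) R) := Metric.isOpen_ball
  have hb : Bornology.IsBounded (Metric.ball (0 : EuclideanSpace ℝ (Fin n)) R) :=
    Metric.isBounded_ball
  -- the origin need not belong to `K_δ`, but it belongs to the larger set `K_{min δ R}`
  have hδ' : 0 < min δ R := lt_min hδ hR
  have h0 := zero_mem_innerSet_ball hn hR (min_le_right δ R)
  obtain ⟨ζ, hζ⟩ := exists_isInnerCutoff hΩ hb hδ'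
  have hκα : 1 / ((n : ℝ) - 1) * ((α - 2) ^ 2 / 4) < 1 := by
    rw [one_div_mul_eq_div, div_lt_one hn1]; exact hα
  obtain ⟨C, hC, h⟩ := exists_weightedGradientBound_of_le hΩ hb hδ' hα₀
    (one_div_nonneg.2 hn1.le) le_rfl hκα hζ
  refine ⟨C, fun f u hf hu hu0 hs => ?_⟩
  have hst := isStableWithPotential_of_isStable hΩ hf hu hs
  have hint := integrableOn_gradSq hΩ hb hu.smooth
  have hW : WeightedGradientBound (Metric.ball 0 R) α (min δ R) C u 0 := by
    refine h u _ hst hint 0 h0 fun ε s hε _ hs => ?_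
    have hG := continuousOn_gradSq hΩ hst.smooth
    have hH := continuousOn_regHess hΩ hst.smooth hs
    have hζc : ContinuousOn ζ (Metric.ball 0 R) := hζ.contDiff.continuous.continuousOn
    have hρc : ∀ e : ℝ, ContinuousOn (fun x => regDistSq 0 ε x ^ e)
        (Metric.ball (0 : EuclideanSpace ℝ (Fin n)) R) :=
      fun e => (contDiff_regDistSq_rpow hε e).continuous.continuousOn
    rw [zero_mul, add_zero, ← integral_const_mul]
    refine setIntegral_mono_on ?_ (Integrable.const_mul ?_ _) hΩ.measurableSet fun x hx => ?_
    · exact hζ.integrableOn hΩ (by fun_prop) fun x hx => by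
        simp [image_eq_zero_of_notMem_tsupport hx]
    · exact hζ.integrableOn hΩ (by fun_prop) fun x hx => by
        simp [image_eq_zero_of_notMem_tsupport hx]
    · have hx1 := gradSq_le_of_angDeriv_eq_zero (ε := ε) hΩ hn hst.smooth
        (fun i j z hz => angDeriv_eq_zero hR hst hu.smooth hu0 hz) hx hs
      have hq := regDistSq_pos (y := 0) hε x
      have hρ : 0 ≤ regDistSq 0 ε x ^ (-α / 2) * ζ x ^ 2 :=
        mul_nonneg (Real.rpow_nonneg hq.le _) (sq_nonneg _)
      rw [mul_pow, rpow_quarter_sq α hq, one_div_mul_eq_div, le_div_iff₀ hn1]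
      linarith [mul_le_mul_of_nonneg_left hx1 hρ]
  obtain ⟨hi, hle⟩ := hW
  refine ⟨hi, hle.trans (mul_le_mul_of_nonneg_left ?_ hC)⟩
  simp only [norm_gradient_sq]
  exact setIntegral_mono_set (hint.mono_set sdiff_subset)
    (Filter.Eventually.of_forall fun x => gradSq_nonneg (u := u) x)
    (sdiff_subset_sdiff_right (innerSet_anti (min_le_left δ R))).eventuallyLE

end RadialEstimate

theorem proposition1p2 (n : ℕ) (α : ℝ) (hα₀ : 0 ≤ α) (hα₁ : α < (n : ℝ) - 1) :
    -- general smooth bounded domains, without boundary condition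
    ((α - 2) ^ 2 / 4 < ((n : ℝ) - 1 - α) ^ 2 / ((n : ℝ) - 1) →
      ∀ Ω : Set (EuclideanSpace ℝ (Fin n)), IsSmoothBoundedDomain Ω →
      ∀ δ : ℝ, 0 < δ →
      ∃ C : ℝ, ∀ (f : ℝ → ℝ) (u : EuclideanSpace ℝ (Fin n) → ℝ),
        ContDiff ℝ 1 f → IsSmoothSolution Ω f u → IsStable Ω f u →
        ∀ y ∈ innerSet Ω δ, WeightedGradientBound Ω α δ C u y) ∧
    -- balls centered at the origin, with the Dirichlet condition
    ((α - 2) ^ 2 / 4 < (n : ℝ) - 1 →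
      ∀ R : ℝ, 0 < R →
      ∀ δ : ℝ, 0 < δ →
      ∃ C : ℝ, ∀ (f : ℝ → ℝ) (u : EuclideanSpace ℝ (Fin n) → ℝ),
        ContDiff ℝ 1 f → IsSmoothSolution (Metric.ball 0 R) f u →
        (∀ x ∈ frontier (Metric.ball (0 : EuclideanSpace ℝ (Fin n)) R), u x = 0) →
        IsStable (Metric.ball 0 R) f u →
        WeightedGradientBound (Metric.ball 0 R) α δ C u 0) :=
  ⟨fun h _ hΩ _ hδ => exists_weightedGradientBound hΩ.isOpen hΩ.isBounded hα₀ hα₁ h hδ,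
    fun h _ hR _ hδ => exists_weightedGradientBound_ball hα₀ hα₁ h hR hδ⟩
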